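/- For $l=1$ let $A_1$ be the associative unital $\mathbb{C}$-algebra with generators $f_0,f_1,f_2,\alpha_0,\alpha_1,h$ and relations $[f_1,f_0]=2hf_2$, $[f_0,f_2]=[f_2,f_1]=h$, $[f_i,\alpha_j]=[h,\alpha_j]=[f_i,h]=[\alpha_0,\alpha_1]=0$. For $l\ge 2$ let $A_l$ be the associative unital $\mathbb{C}$-algebra with generators $f_i,\alpha_i$ ($i\in\mathbb{Z}/(l+1)\mathbb{Z}$), $h$ and relations $[f_i,f_{i+1}]=h$, $[f_i,f_j]=0$ ($j\neq i\pm1$), $[f_i,\alpha_j]=[\alpha_i,\alpha_j]=[h,f_j]=[h,\alpha_j]=0$. Then $A_l$ is a domain satisfying the (left) Ore condition for every $l\ge1$; let $\mathcal{K}_l$ be its quotient skew field. For $l\ge 2$ and $i,j\in\mathbb{Z}/(l+1)\mathbb{Z}$ put $a_{ii}=2$, $a_{i,i\pm1}=-1$, $a_{ij}=0$ ($j\ne i,i\pm1$), and $u_{i,i\pm1}=\pm1$, $u_{ij}=0$ ($j\neq i\pm1$). **Theorem.** For every $l\ge 1$ there are unique $\mathbb{C}$-algebra automorphisms $s_0,\dots,s_l,\pi$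 of $\mathcal{K}_l$ such that: (1) for $l=1$, $$s_0(f_0)=f_0,\quad s_0(f_1)=f_1-f_2\frac{\alpha_0}{f_0}-\frac{\alpha_0}{f_0}f_2-\frac{\alpha_0^2}{f_0^2},\quad s_0(f_2)=f_2+\frac{\alpha_0}{f_0},$$ $$s_1(f_0)=f_0+f_2\frac{\alpha_1}{f_1}+\frac{\alpha_1}{f_1}f_2-\frac{\alpha_1^2}{f_1^2},\quad s_1(f_1)=f_1,\quad s_1(f_2)=f_2-\frac{\alpha_1}{f_1},$$ $$s_0(\alpha_0)=-\alpha_0,\quad s_0(\alpha_1)=\alpha_1+2\alpha_0,\quad s_1(\alpha_0)=\alpha_0+2\alpha_1,\quad s_1(\alpha_1)=-\alpha_1,$$ $$\pi(f_0)=f_1,\quad \pi(f_1)=f_0,\quad \pi(f_2)=-f_2,\quad \pi(\alpha_0)=\alpha_1,\quad \pi(\alpha_1)=\alpha_0,$$ $$s_0(h)=s_1(h)=\pi(h)=h;$$ (2) for $l\ge2$ and all $i,j\in\mathbb{Z}/(l+1)\mathbb{Z}$, $$s_i(f_j)=f_j+\frac{\alpha_i}{f_i}u_{ij},\quad s_i(\alpha_j)=\alpha_j-\alpha_ia_{ij},\quad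 s_i(h)=h,\quad \pi(f_j)=f_{j+1},\quad \pi(\alpha_j)=\alpha_{j+1},\quad \pi(h)=h.$$ In the group $\mathrm{Aut}_{\mathbb{C}}(\mathcal{K}_l)$ (with composition of maps as product) they satisfy, with indices in $\mathbb{Z}/(l+1)\mathbb{Z}$, $$s_i^2=1,\qquad (s_is_j)^3=1\ (j=i\pm1;\ \text{only for } l\ge2),\qquad s_is_j=s_js_i\ (j\neq i\pm1),$$ $$\pi^{l+1}=1,\qquad \pi s_i=s_{i+1}\pi .$$ That is, they define a representation on $\mathcal{K}_l$ (a group homomorphism to $\mathrm{Aut}_{\mathbb{C}}(\mathcal{K}_l)$) of the extended affine Weyl group $\widetilde W=\langle s_0,\dots,s_l,\pi\rangle$ of type $A_l^{(1)}$, the group presented by these relations. -/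

import Mathlib

noncomputable section

namespace QuantumPainleve

open scoped nonZeroDivisors

/-! The algebra of type `A_l^{(1)}` for `l ≥ 2` -/

/-- Generators `f_i`, `α_i` (`i ∈ ℤ/(l+1)ℤ`) and `h`. -/
inductive Gen (l : ℕ) : Type
  | f (i : ZMod (l + 1)) : Gen l
  | α (i : ZMod (l + 1)) : Gen l
  | h : Gen l

/-- A generator as an element of the free algebra. -/
abbrev Gen.toFree {l : ℕ} (x : Gen l) : FreeAlgebra ℂ (Gen l) := FreeAlgebra.ι ℂ x

/-- The fundamental relations `[f_i, f_{i+1}] = h`, `[f_i, f_j] = 0` for `j ≠ i ± 1`,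
and `α_i`, `h` commute with all generators (for `l ≥ 2`). -/
inductive Rel (l : ℕ) : FreeAlgebra ℂ (Gen l) → FreeAlgebra ℂ (Gen l) → Prop
  | f_f_succ (i : ZMod (l + 1)) :
      Rel l ⁅(Gen.f (l := l) i).toFree, (Gen.f (l := l) (i + 1)).toFree⁆
        (Gen.h (l := l)).toFree
  | f_f (i j : ZMod (l + 1)) (h₁ : j ≠ i + 1) (h₂ : j ≠ i - 1) :
      Rel l ⁅(Gen.f (l := l) i).toFree, (Gen.f (l := l) j).toFree⁆ 0
  | f_α (i j : ZMod (l + 1)) :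
      Rel l ⁅(Gen.f (l := l) i).toFree, (Gen.α (l := l) j).toFree⁆ 0
  | α_α (i j : ZMod (l + 1)) :
      Rel l ⁅(Gen.α (l := l) i).toFree, (Gen.α (l := l) j).toFree⁆ 0
  | h_f (j : ZMod (l + 1)) :
      Rel l ⁅(Gen.h (l := l)).toFree, (Gen.f (l := l) j).toFree⁆ 0
  | h_α (j : ZMod (l + 1)) :
      Rel l ⁅(Gen.h (l := l)).toFree, (Gen.α (l := l) j).toFree⁆ 0

/-- The associative `ℂ`-algebra with the generators `Gen l` and the relations `Rel l`. -/
abbrev Alg (l : ℕ) : Type := RingQuot (Rel l)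

/-- The class of a generator in the algebra. -/
def Alg.gen (l : ℕ) (x : Gen l) : Alg l :=
  RingQuot.mkAlgHom ℂ (Rel l) (FreeAlgebra.ι ℂ x)

/-! The algebra of type `A_1^{(1)}` -/

/-- Generators `f_0, f_1, f_2`, `α_0, α_1` and `h`. -/
inductive Gen₁ : Type
  | f (i : Fin 3) : Gen₁
  | α (i : ZMod 2) : Gen₁
  | h : Gen₁

/-- The fundamental relations `[f_1, f_0] = 2 h f_2`, `[f_0, f_2] = [f_2, f_1] = h`,
and `α_i`, `h` commute with all generators. -/
inductive Rel₁ : FreeAlgebra ℂ Gen₁ → FreeAlgebra ℂ Gen₁ → Prop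
  | f₁_f₀ :
      Rel₁ ⁅FreeAlgebra.ι ℂ (Gen₁.f 1), FreeAlgebra.ι ℂ (Gen₁.f 0)⁆
        (2 * FreeAlgebra.ι ℂ Gen₁.h * FreeAlgebra.ι ℂ (Gen₁.f 2))
  | f₀_f₂ :
      Rel₁ ⁅FreeAlgebra.ι ℂ (Gen₁.f 0), FreeAlgebra.ι ℂ (Gen₁.f 2)⁆ (FreeAlgebra.ι ℂ Gen₁.h)
  | f₂_f₁ :
      Rel₁ ⁅FreeAlgebra.ι ℂ (Gen₁.f 2), FreeAlgebra.ι ℂ (Gen₁.f 1)⁆ (FreeAlgebra.ι ℂ Gen₁.h)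
  | f_α (i : Fin 3) (j : ZMod 2) :
      Rel₁ ⁅FreeAlgebra.ι ℂ (Gen₁.f i), FreeAlgebra.ι ℂ (Gen₁.α j)⁆ 0
  | α_α (i j : ZMod 2) :
      Rel₁ ⁅FreeAlgebra.ι ℂ (Gen₁.α i), FreeAlgebra.ι ℂ (Gen₁.α j)⁆ 0
  | f_h (i : Fin 3) :
      Rel₁ ⁅FreeAlgebra.ι ℂ (Gen₁.f i), FreeAlgebra.ι ℂ Gen₁.h⁆ 0
  | h_α (j : ZMod 2) :
      Rel₁ ⁅FreeAlgebra.ι ℂ Gen₁.h, FreeAlgebra.ι ℂ (Gen₁.α j)⁆ 0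

/-- The associative `ℂ`-algebra with the generators `Gen₁` and the relations `Rel₁`. -/
abbrev Alg₁ : Type := RingQuot Rel₁

/-- The class of a generator in the algebra. -/
def Alg₁.gen (x : Gen₁) : Alg₁ :=
  RingQuot.mkAlgHom ℂ Rel₁ (FreeAlgebra.ι ℂ x)

/-! The quotient skew field -/

/-- The ring of left fractions of `R` with respect to all nonzerodivisors; for an Ore domain `R`
this is its quotient skew field. -/
abbrev QuotField (R : Type) [Ring R] [OreLocalization.OreSet R⁰] : Type :=
  OreLocalization R⁰ R

/-- The canonical map from `R` to its quotient skew field. -/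
def toQuot {R : Type} [Ring R] [OreLocalization.OreSet R⁰] (r : R) : QuotField R :=
  OreLocalization.numeratorHom r

/-! The matrices `A = (a_{ij})` and `U = (u_{ij})` for `l ≥ 2` -/

/-- The generalized Cartan matrix of type `A_l^{(1)}`, `l ≥ 2`. -/
def a (l : ℕ) (i j : ZMod (l + 1)) : ℤ :=
  if j = i then 2 else if j = i + 1 ∨ j = i - 1 then -1 else 0

/-- The matrix with `u_{i,i+1} = 1`, `u_{i,i-1} = -1` and zero entries elsewhere, `l ≥ 2`. -/
def u (l : ℕ) (i j : ZMod (l + 1)) : ℤ :=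
  if j = i + 1 then 1 else if j = i - 1 then -1 else 0

/-! The defining formulas of the automorphisms -/

/-- The formulas for `s_i` and `π` on the generators, `l ≥ 2`. -/
structure Formulas (l : ℕ) {K : Type} [DivisionRing K] [Algebra ℂ K]
    (f α : ZMod (l + 1) → K) (h : K)
    (s : ZMod (l + 1) → (K ≃ₐ[ℂ] K)) (π : K ≃ₐ[ℂ] K) : Prop where
  s_f : ∀ i j, s i (f j) = f j + α i / f i * (u l i j : K)
  s_α : ∀ i j, s i (α j) = α j - α i * (a l i j : K)
  s_h : ∀ i, s i h = h
  π_f : ∀ j, π (f j) = f (j + 1)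
  π_α : ∀ j, π (α j) = α (j + 1)
  π_h : π h = h

/-- The formulas for `s_0`, `s_1` and `π` on the generators, `l = 1`. -/
structure Formulas₁ {K : Type} [DivisionRing K] [Algebra ℂ K]
    (f : Fin 3 → K) (α : ZMod 2 → K) (h : K)
    (s : ZMod 2 → (K ≃ₐ[ℂ] K)) (π : K ≃ₐ[ℂ] K) : Prop where
  s₀_f₀ : s 0 (f 0) = f 0
  s₀_f₁ : s 0 (f 1) = f 1 - f 2 * (α 0 / f 0) - α 0 / f 0 * f 2 - α 0 ^ 2 / f 0 ^ 2
  s₀_f₂ : s 0 (f 2) = f 2 + α 0 / f 0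
  s₁_f₀ : s 1 (f 0) = f 0 + f 2 * (α 1 / f 1) + α 1 / f 1 * f 2 - α 1 ^ 2 / f 1 ^ 2
  s₁_f₁ : s 1 (f 1) = f 1
  s₁_f₂ : s 1 (f 2) = f 2 - α 1 / f 1
  s₀_α₀ : s 0 (α 0) = -α 0
  s₀_α₁ : s 0 (α 1) = α 1 + 2 * α 0
  s₁_α₀ : s 1 (α 0) = α 0 + 2 * α 1
  s₁_α₁ : s 1 (α 1) = -α 1
  s_h : ∀ i, s i h = h
  π_f₀ : π (f 0) = f 1
  π_f₁ : π (f 1) = f 0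
  π_f₂ : π (f 2) = -f 2
  π_α₀ : π (α 0) = α 1
  π_α₁ : π (α 1) = α 0
  π_h : π h = h

/-! The extended affine Weyl group -/

/-- Elements `s_i` (`i ∈ ℤ/(l+1)ℤ`) and `π` of a group satisfy the defining relations of the
extended affine Weyl group of type `A_l^{(1)}`; there is no braid relation when `l = 1`. -/
structure WeylRelations (l : ℕ) {G : Type} [Group G] (s : ZMod (l + 1) → G) (π : G) : Prop where
  sq : ∀ i, s i ^ 2 = 1
  braid : 2 ≤ l → ∀ i j, (j = i + 1 ∨ j = i - 1) → (s i * s j) ^ 3 = 1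
  comm : ∀ i j, j ≠ i + 1 → j ≠ i - 1 → s i * s j = s j * s i
  π_pow : π ^ (l + 1) = 1
  π_s : ∀ i, π * s i = s (i + 1) * π

/-- Generators of the extended affine Weyl group. -/
inductive WeylGen (l : ℕ) : Type
  | s (i : ZMod (l + 1)) : WeylGen l
  | π : WeylGen l

open WeylGen in
/-- The relators of the extended affine Weyl group. -/
inductive WeylRelator (l : ℕ) : FreeGroup (WeylGen l) → Prop
  | sq (i : ZMod (l + 1)) : WeylRelator l (FreeGroup.of (s i) ^ 2)
  | braid (hl : 2 ≤ l) (i j : ZMod (l + 1)) (hj : j = i + 1 ∨ j = i - 1) :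
      WeylRelator l ((FreeGroup.of (s i) * FreeGroup.of (s j)) ^ 3)
  | comm (i j : ZMod (l + 1)) (h₁ : j ≠ i + 1) (h₂ : j ≠ i - 1) :
      WeylRelator l ((FreeGroup.of (s i) * FreeGroup.of (s j)) *
        (FreeGroup.of (s j) * FreeGroup.of (s i))⁻¹)
  | π_pow : WeylRelator l (FreeGroup.of π ^ (l + 1))
  | π_s (i : ZMod (l + 1)) :
      WeylRelator l ((FreeGroup.of π * FreeGroup.of (s i)) *
        (FreeGroup.of (s (i + 1)) * FreeGroup.of π)⁻¹)

/-- The extended affine Weyl group `⟨s_0, …, s_l, π⟩` of type `A_l^{(1)}`, `l ≥ 1`. -/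
abbrev ExtWeyl (l : ℕ) : Type := PresentedGroup {r | WeylRelator l r}

/-- `s_i` and `π` define a representation of the extended affine Weyl group. -/
def DefinesRepresentation (l : ℕ) {G : Type} [Group G] (s : ZMod (l + 1) → G) (π : G) : Prop :=
  ∃ ρ : ExtWeyl l →* G,
    (∀ i, ρ (PresentedGroup.of (WeylGen.s i)) = s i) ∧ ρ (PresentedGroup.of WeylGen.π) = π

end QuantumPainleve

end

/-! Both algebras are handled as deformations of a polynomial ring. Let the generators act on
polynomials as multiplication by a variable plus a derivation that does not raise the degree, and
call `φ a 1` the symbol of `a`. The leading form of the symbol of a word is the corresponding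
monomial, and reordering a word only adds shorter words. Hence the symbol map is injective, detects
word length exactly, and is multiplicative up to lower degree. It plays the role of a PBW theorem.
Since degrees of polynomials add under multiplication, the algebra is a domain. Since the words of
length less than `n` span at most `n ^ N` dimensions (`N` generators), two nonzero elements have a
common left multiple: otherwise the dimension would double at every bounded step. The required
action exists when all commutators of generators are scalar multiples of a central generator; this
is a Heisenberg-type representation (`heisenbergOp`). For `l ≥ 2` the given generators qualify. For
`l = 1` the element `f₀ + f₁ + f₂²` is central, and using it in place of `f₁` leaves `[f₀, f₂] = h`
as the only nontrivial relation. The formulas for `s_i` respect the defining relations, so they give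
a homomorphism from the algebra to its skew field. Extending it to the skew field requires
injectivity, which comes from `s_i` being an involution on generators after denominators are
cleared. The denominators are powers of `f_i`, and these can be moved past any element because
commutators with `f_i` are, on generators, central multiples of `h`. The rotation `π` already acts
on the algebra. All relations of automorphisms are then checked on generators. For `l ≥ 2` the braid
relation amounts to one noncommutative continued fraction identity, `continued_fraction_identity`.
For `l = 1` there is no braid relation, and `s₁ = π s₀ π` leaves only two involutions to verify. -/

noncomputable section

namespace QuantumPainleve

open MvPolynomial

/-! ### Filtration by word length, symbols, and the Ore condition from polynomial growth -/

section WordFiltration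

variable {A σ : Type*} [Ring A] [Algebra ℂ A]

/-- The span of the words of length less than `n` in the family `g`. -/
def wordLt (g : σ → A) (n : ℕ) : Submodule ℂ A :=
  Submodule.span ℂ {x | ∃ w : List σ, w.length < n ∧ (w.map g).prod = x}

/-- The polynomials of total degree less than `n`. -/
def polyLt (σ : Type*) (n : ℕ) : Submodule ℂ (MvPolynomial σ ℂ) :=
  restrictSupport ℂ {m | m.degree < n}

variable {g : σ → A} {n k : ℕ}

theorem prod_mem_wordLt {w : List σ} (h : w.length < n) : (w.map g).prod ∈ wordLt g n :=
  Submodule.subset_span ⟨w, h, rfl⟩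

theorem wordLt_mono (h : n ≤ k) : wordLt g n ≤ wordLt g k :=
  Submodule.span_mono fun _ ⟨w, hw, e⟩ => ⟨w, hw.trans_le h, e⟩

theorem wordLt_zero : wordLt g 0 = ⊥ := by
  simp [wordLt]

theorem mul_mem_wordLt {a b : A} (ha : a ∈ wordLt g n) (hb : b ∈ wordLt g k) :
    a * b ∈ wordLt g (n + k - 1) := by
  have h := Submodule.mul_mem_mul ha hb
  rw [wordLt, wordLt, Submodule.span_mul_span] at h
  refine Submodule.span_mono ?_ h
  rintro _ ⟨_, ⟨w, hw, rfl⟩, _, ⟨v, hv, rfl⟩, rfl⟩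
  exact ⟨w ++ v, by simp; omega, by simp⟩

theorem gen_mem_wordLt (i : σ) : g i ∈ wordLt g 2 := by
  simpa using prod_mem_wordLt (g := g) (w := [i]) (n := 2) (by simp)

theorem one_mem_wordLt : (1 : A) ∈ wordLt g 1 := by
  simpa using prod_mem_wordLt (g := g) (w := []) (n := 1) (by simp)

theorem exists_mem_wordLt (hg : Algebra.adjoin ℂ (Set.range g) = ⊤) (a : A) :
    ∃ n, a ∈ wordLt g n := by
  have ha : a ∈ Algebra.adjoin ℂ (Set.range g) := hg ▸ Algebra.mem_top
  induction ha using Algebra.adjoin_induction with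
  | mem x hx => obtain ⟨i, rfl⟩ := hx; exact ⟨2, gen_mem_wordLt i⟩
  | algebraMap r =>
    exact ⟨1, by rw [Algebra.algebraMap_eq_smul_one]; exact Submodule.smul_mem _ _ one_mem_wordLt⟩
  | add x y _ _ hx hy =>
    obtain ⟨n, hn⟩ := hx
    obtain ⟨k, hk⟩ := hy
    exact ⟨max n k, add_mem (wordLt_mono (le_max_left _ _) hn) (wordLt_mono (le_max_right _ _) hk)⟩
  | mul x y _ _ hx hy =>
    obtain ⟨n, hn⟩ := hx
    obtain ⟨k, hk⟩ := hy
    exact ⟨_, mul_mem_wordLt hn hk⟩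

/-- A permutation is a chain of adjacent swaps. Each swap changes the product by a commutator put in
place of two letters, and commutators have word length at most one, so the change is shorter. -/
theorem prod_sub_prod_mem_wordLt
    (hc : ∀ i j, g i * g j - g j * g i ∈ wordLt g 2) {w v : List σ} (h : w.Perm v) :
    (w.map g).prod - (v.map g).prod ∈ wordLt g w.length := by
  induction h with
  | nil => simp
  | @cons i w v _ ih =>
    have := mul_mem_wordLt (gen_mem_wordLt (g := g) i) ih
    rw [mul_sub] at this
    simpa [add_comm] using wordLt_mono (by omega) this
  | swap i j w =>
    have := mul_mem_wordLt (hc j i) (prod_mem_wordLt (g := g) (Nat.lt_succ_self w.length))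
    simp only [List.map_cons, List.prod_cons, List.length_cons, ← mul_assoc, ← sub_mul]
    exact wordLt_mono (by omega) this
  | trans h₁ _ ih₁ ih₂ =>
    rw [← sub_add_sub_cancel]
    exact add_mem ih₁ (h₁.length_eq ▸ ih₂)

theorem mem_polyLt {p : MvPolynomial σ ℂ} :
    p ∈ polyLt σ n ↔ ∀ m, n ≤ m.degree → coeff m p = 0 := by
  rw [polyLt, mem_restrictSupport_iff]
  constructor
  · intro h m hm
    by_contra h0
    exact absurd (h (mem_support_iff.2 h0)) (not_lt.2 hm)
  · intro h m hm
    by_contra h0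
    exact mem_support_iff.1 hm (h m (not_lt.1 h0))

theorem polyLt_mono (h : n ≤ k) : polyLt σ n ≤ polyLt σ k := fun _ hp =>
  mem_polyLt.2 fun m hm => mem_polyLt.1 hp m (h.trans hm)

theorem monomial_mem_polyLt {m : σ →₀ ℕ} (h : m.degree < n) (r : ℂ) :
    monomial m r ∈ polyLt σ n := by
  classical
  refine mem_polyLt.2 fun m' hm' => ?_
  rw [coeff_monomial, if_neg]
  rintro rfl
  omega

theorem polyLt_eq_span :
    polyLt σ n = Submodule.span ℂ ((fun m => monomial m (1 : ℂ)) '' {m | m.degree < n}) := by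
  rw [polyLt, restrictSupport_eq_span]

theorem mul_mem_polyLt {p q : MvPolynomial σ ℂ} (hp : p ∈ polyLt σ n) (hq : q ∈ polyLt σ k) :
    p * q ∈ polyLt σ (n + k - 1) := by
  have h := Submodule.mul_mem_mul hp hq
  rw [polyLt_eq_span, polyLt_eq_span, Submodule.span_mul_span] at h
  rw [polyLt_eq_span]
  refine Submodule.span_mono ?_ h
  rintro _ ⟨_, ⟨m, hm, rfl⟩, _, ⟨m', hm', rfl⟩, rfl⟩
  refine ⟨m + m', ?_, by simp [monomial_mul]⟩
  simp only [Set.mem_ofPred_eq, map_add] at *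
  omega

theorem X_mem_polyLt (i : σ) : (X i : MvPolynomial σ ℂ) ∈ polyLt σ 2 :=
  monomial_mem_polyLt (by simp) 1

theorem mem_polyLt_iff_totalDegree_lt {p : MvPolynomial σ ℂ} (hp : p ≠ 0) :
    p ∈ polyLt σ n ↔ p.totalDegree < n := by
  rcases n.eq_zero_or_pos with rfl | hn
  · simp only [not_lt_zero, iff_false]
    exact fun h => hp (MvPolynomial.ext _ _ fun m => mem_polyLt.1 h m (Nat.zero_le _))
  · rw [polyLt, mem_restrictSupport_iff, totalDegree, Finset.sup_lt_iff hn]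
    rfl

/-- The monomial of a word in commuting variables. -/
def wordExp (w : List σ) : σ →₀ ℕ := (w.map fun i => Finsupp.single i 1).sum

theorem degree_wordExp (w : List σ) : (wordExp w).degree = w.length := by
  induction w with
  | nil => simp [wordExp]
  | cons i w ih => simp_all [wordExp, add_comm]

theorem toMultiset_wordExp (w : List σ) : Finsupp.toMultiset (wordExp w) = w := by
  induction w with
  | nil => simp [wordExp]
  | cons i w ih =>
    rw [wordExp, List.map_cons, List.sum_cons, map_add, ← wordExp, ih]
    simp

theorem toList_wordExp_perm (w : List σ) :
    (Finsupp.toMultiset (wordExp w)).toList.Perm w := by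
  rw [← Multiset.coe_eq_coe, Multiset.coe_toList, toMultiset_wordExp]

/-- The linear map that sends each monomial to a product of the `g i` in some order. -/
def orderedProd (g : σ → A) : MvPolynomial σ ℂ →ₗ[ℂ] A :=
  (basisMonomials σ ℂ).constr ℂ fun m => ((Finsupp.toMultiset m).toList.map g).prod

theorem orderedProd_monomial (m : σ →₀ ℕ) :
    orderedProd g (monomial m 1) = ((Finsupp.toMultiset m).toList.map g).prod := by
  rw [orderedProd, ← congrFun (coe_basisMonomials σ ℂ) m, Module.Basis.constr_basis]

theorem orderedProd_mem_wordLt {p : MvPolynomial σ ℂ} (hp : p ∈ polyLt σ n) :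
    orderedProd g p ∈ wordLt g n := by
  rw [polyLt_eq_span] at hp
  refine (Submodule.span_le.2 ?_ : _ ≤ (wordLt g n).comap (orderedProd g)) hp
  rintro _ ⟨m, hm, rfl⟩
  simp only [Submodule.comap_coe, Set.mem_preimage, orderedProd_monomial, SetLike.mem_coe]
  refine prod_mem_wordLt ?_
  rw [Multiset.length_toList, Finsupp.card_toMultiset]
  exact hm

/-- `φ` is a representation on polynomials in which the generators `g i`, whose commutators are
of degree at most one, act as multiplication by variables up to terms that do not raise the
degree. -/
structure IsSymbolRep (g : σ → A) (φ : A →ₐ[ℂ] Module.End ℂ (MvPolynomial σ ℂ)) : Prop where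
  adjoin_eq_top : Algebra.adjoin ℂ (Set.range g) = ⊤
  comm_mem : ∀ i j, g i * g j - g j * g i ∈ wordLt g 2
  act_mem : ∀ i n q, q ∈ polyLt σ n → φ (g i) q - X i * q ∈ polyLt σ n

/-- The value of an operator at `1`. -/
def symbolMap (φ : A →ₐ[ℂ] Module.End ℂ (MvPolynomial σ ℂ)) : A →ₗ[ℂ] MvPolynomial σ ℂ :=
  (LinearMap.applyₗ (1 : MvPolynomial σ ℂ)).comp φ.toLinearMap

variable {φ : A →ₐ[ℂ] Module.End ℂ (MvPolynomial σ ℂ)}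

theorem symbolMap_apply (a : A) : symbolMap φ a = φ a 1 := rfl

namespace IsSymbolRep

variable (H : IsSymbolRep g φ)
include H

theorem symbolMap_word (w : List σ) :
    symbolMap φ (w.map g).prod - monomial (wordExp w) 1 ∈ polyLt σ w.length := by
  induction w with
  | nil => simp [symbolMap_apply, wordExp]
  | cons i w ih =>
    have e : symbolMap φ ((i :: w).map g).prod = φ (g i) (symbolMap φ (w.map g).prod) := by
      simp [symbolMap_apply]
    have e' : monomial (wordExp (i :: w)) (1 : ℂ) = X i * monomial (wordExp w) 1 := by
      simp [wordExp, X, monomial_mul]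
    rw [e, e', ← sub_add_sub_cancel _ (X i * symbolMap φ (w.map g).prod), ← mul_sub]
    refine add_mem (H.act_mem _ _ _ ?_) ?_
    · rw [← sub_add_cancel (symbolMap φ _) (monomial (wordExp w) 1)]
      exact add_mem (polyLt_mono (by simp) ih)
        (monomial_mem_polyLt (by simp [degree_wordExp]) 1)
    · exact polyLt_mono (by simp; omega) (mul_mem_polyLt (X_mem_polyLt i) ih)

theorem symbolMap_mem {a : A} (ha : a ∈ wordLt g n) : symbolMap φ a ∈ polyLt σ n := by
  refine (Submodule.span_le.2 ?_ : _ ≤ (polyLt σ n).comap (symbolMap φ)) ha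
  rintro _ ⟨w, hw, rfl⟩
  have := H.symbolMap_word w
  simp only [Submodule.comap_coe, Set.mem_preimage, SetLike.mem_coe]
  rw [← sub_add_cancel (symbolMap φ _) (monomial (wordExp w) 1)]
  exact add_mem (polyLt_mono hw.le this)
    (monomial_mem_polyLt (by rwa [degree_wordExp]) 1)

/-- The leading monomial of the symbol of a word is the multiset of its letters, so `orderedProd`
returns the same letters in another order. The symbol therefore recovers an element up to shorter
words. -/
theorem sub_orderedProd_symbolMap_mem {a : A} (ha : a ∈ wordLt g (n + 1)) :
    a - orderedProd g (symbolMap φ a) ∈ wordLt g n := by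
  refine (Submodule.span_le.2 ?_ : _ ≤ (wordLt g n).comap
    (LinearMap.id - (orderedProd g).comp (symbolMap φ))) ha
  rintro _ ⟨w, hw, rfl⟩
  simp only [Submodule.comap_coe, Set.mem_preimage, SetLike.mem_coe, LinearMap.sub_apply,
    LinearMap.id_apply, LinearMap.comp_apply]
  have h₁ := prod_sub_prod_mem_wordLt H.comm_mem (toList_wordExp_perm w).symm
  rw [← orderedProd_monomial] at h₁
  have h₂ := orderedProd_mem_wordLt (g := g) (H.symbolMap_word w)
  rw [map_sub] at h₂
  have := wordLt_mono (Nat.lt_succ_iff.1 hw) (sub_mem h₁ h₂)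
  convert this using 1
  abel

theorem mem_of_symbolMap_mem {a : A} (h : symbolMap φ a ∈ polyLt σ n) : a ∈ wordLt g n := by
  obtain ⟨k, hk⟩ := exists_mem_wordLt H.adjoin_eq_top a
  induction k with
  | zero => exact wordLt_mono (Nat.zero_le _) hk
  | succ k ih =>
    rcases le_or_gt (k + 1) n with hn | hn
    · exact wordLt_mono hn hk
    -- With `n ≤ k`, both the difference from the ordered product and the ordered product itself lie
    -- in `wordLt g k`, so the bound descends by one.
    · refine ih ?_
      rw [← sub_add_cancel a (orderedProd g (symbolMap φ a))]
      exact add_mem (H.sub_orderedProd_symbolMap_mem hk)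
        (orderedProd_mem_wordLt (polyLt_mono (by omega) h))

theorem mem_iff {a : A} : a ∈ wordLt g n ↔ symbolMap φ a ∈ polyLt σ n :=
  ⟨H.symbolMap_mem, H.mem_of_symbolMap_mem⟩

theorem symbolMap_injective : Function.Injective (symbolMap φ) := by
  rw [← LinearMap.ker_eq_bot, LinearMap.ker_eq_bot']
  intro a ha
  -- The strict inequality in the filtrations pays off: level zero is the zero subspace, so a
  -- vanishing symbol forces `a = 0`.
  have : a ∈ wordLt g 0 := H.mem_iff.2 (ha ▸ zero_mem _)
  simpa [wordLt_zero] using this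

/-- By bilinearity this is a statement about words. There the leading monomials multiply exactly,
and both correction terms have lower degree. -/
theorem symbolMap_mul_sub_mem {a b : A} (ha : a ∈ wordLt g (n + 1)) (hb : b ∈ wordLt g (k + 1)) :
    symbolMap φ (a * b) - symbolMap φ a * symbolMap φ b ∈ polyLt σ (n + k) := by
  induction ha, hb using Submodule.span_induction₂ with
  | mem_mem x y hx hy =>
    obtain ⟨w, hw, rfl⟩ := hx
    obtain ⟨v, hv, rfl⟩ := hy
    have e : monomial (wordExp (w ++ v)) (1 : ℂ) =
        monomial (wordExp w) 1 * monomial (wordExp v) 1 := by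
      simp [wordExp, monomial_mul]
    have h := H.symbolMap_word (w ++ v)
    have hw' := H.symbolMap_word w
    have hv' := H.symbolMap_word v
    have h₁ := mul_mem_polyLt hw' (H.symbolMap_mem (prod_mem_wordLt (Nat.lt_succ_self v.length)))
    have h₂ := mul_mem_polyLt (monomial_mem_polyLt (n := w.length + 1)
      (m := wordExp w) (by simp [degree_wordExp]) (1 : ℂ)) hv'
    rw [List.map_append, List.prod_append, e, List.length_append] at h
    have := sub_mem (polyLt_mono (k := n + k) (by omega) h)
      (add_mem (polyLt_mono (k := n + k) (by omega) h₁) (polyLt_mono (k := n + k) (by omega) h₂))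
    convert this using 1
    ring
  | zero_left y hy => simp
  | zero_right x hx => simp
  | add_left x y z _ _ _ h₁ h₂ =>
    convert add_mem h₁ h₂ using 1
    rw [add_mul, map_add, map_add]; ring
  | add_right x y z _ _ _ h₁ h₂ =>
    convert add_mem h₁ h₂ using 1
    rw [mul_add, map_add, map_add]; ring
  | smul_left r x y _ _ h =>
    convert Submodule.smul_mem _ r h using 1
    simp [smul_sub]
  | smul_right r x y _ _ h =>
    convert Submodule.smul_mem _ r h using 1
    simp [smul_sub]

theorem gen_ne_zero (i : σ) : g i ≠ 0 := fun h => by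
  have := H.act_mem i 1 1 (monomial_mem_polyLt (m := 0) (by simp) 1)
  rw [h, map_zero, LinearMap.zero_apply, zero_sub, neg_mem_iff, mul_one] at this
  simpa using mem_polyLt.1 this (Finsupp.single i 1) (by simp)

theorem exists_order {a : A} (ha : a ≠ 0) :
    ∃ n, a ∈ wordLt g (n + 1) ∧ symbolMap φ a ≠ 0 ∧ (symbolMap φ a).totalDegree = n := by
  have h0 : symbolMap φ a ≠ 0 := fun h => ha (H.symbolMap_injective (by rw [h, map_zero]))
  exact ⟨_, H.mem_iff.2 ((mem_polyLt_iff_totalDegree_lt h0).2 (Nat.lt_succ_self _)), h0, rfl⟩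

theorem isDomain : IsDomain A := by
  have : Nontrivial A := ⟨1, 0, fun h => by
    have := congrArg (symbolMap φ) h
    simp [symbolMap_apply] at this⟩
  have : NoZeroDivisors A := ⟨by
    intro a b hab
    by_contra! h
    obtain ⟨n, ha, ha0, hn⟩ := H.exists_order h.1
    obtain ⟨k, hb, hb0, hk⟩ := H.exists_order h.2
    -- If `a * b = 0`, the product of the symbols, of degree exactly `n + k`, would have degree less
    -- than `n + k`.
    have := H.symbolMap_mul_sub_mem ha hb
    rw [hab, map_zero, zero_sub, neg_mem_iff,
      mem_polyLt_iff_totalDegree_lt (mul_ne_zero ha0 hb0), totalDegree_mul_of_isDomain ha0 hb0] at this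
    omega⟩
  exact NoZeroDivisors.to_isDomain A

/-- The coefficients of the symbol at exponents with entries less than `n`. -/
theorem exists_injective_coeff [Finite σ] (n : ℕ) :
    ∃ F : wordLt g n →ₗ[ℂ] ((σ → Fin n) → ℂ), Function.Injective F := by
  refine ⟨LinearMap.pi fun v =>
    (lcoeff ℂ (Finsupp.equivFunOnFinite.symm fun i => (v i : ℕ))).comp
      ((symbolMap φ).comp (wordLt g n).subtype), ?_⟩
  rw [← LinearMap.ker_eq_bot, LinearMap.ker_eq_bot']
  rintro ⟨a, ha⟩ h
  have ha' := H.mem_iff.1 ha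
  refine Subtype.ext (H.symbolMap_injective ?_)
  rw [Submodule.coe_zero, map_zero]
  refine MvPolynomial.ext _ _ fun m => ?_
  rcases le_or_gt n m.degree with hm | hm
  · rw [mem_polyLt.1 ha' m hm, coeff_zero]
  · have := congrFun h fun i => ⟨m i, (Finsupp.le_degree i m).trans_lt hm⟩
    simpa using this

theorem finite_wordLt [Finite σ] (n : ℕ) : Module.Finite ℂ (wordLt g n) := by
  obtain ⟨F, hF⟩ := H.exists_injective_coeff n
  exact Module.Finite.of_injective F hF

theorem finrank_wordLt_le [Fintype σ] (n : ℕ) :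
    Module.finrank ℂ (wordLt g n) ≤ n ^ Fintype.card σ := by
  classical
  obtain ⟨F, hF⟩ := H.exists_injective_coeff n
  simpa using LinearMap.finrank_le_finrank_of_injective hF

-- For `m ≥ 1` the base is at most `(1 + k) * m`, and `m ^ N / 2 ^ m` tends to zero.
omit H in
theorem exists_pow_lt_two_pow (k N : ℕ) : ∃ m : ℕ, (1 + m * k) ^ N < 2 ^ m := by
  have h := (tendsto_pow_const_div_const_pow_of_one_lt N (one_lt_two (α := ℝ))).const_mul
    (((1 + k : ℕ) : ℝ) ^ N)
  rw [mul_zero] at h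
  obtain ⟨m, hm, hm1⟩ := ((h.eventually_lt_const zero_lt_one).and
    (Filter.eventually_ge_atTop 1)).exists
  refine ⟨m, ?_⟩
  have h2 : (0 : ℝ) < 2 ^ m := by positivity
  rw [← mul_div_assoc, div_lt_one h2, ← mul_pow] at hm
  refine lt_of_le_of_lt (Nat.pow_le_pow_left (?_ : _ ≤ (1 + k) * m) N) (by exact_mod_cast hm)
  nlinarith

/-- Without a common left multiple the left ideals generated by `r` and `s` would meet only in zero.
Multiplication by `r` and by `s` would then embed two copies of each filtration level in a level `k`
steps higher, giving exponential growth against the polynomial bound. -/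
theorem exists_left_common_multiple [Finite σ] (r s : A) (hs : s ≠ 0) :
    ∃ r' s' : A, s' ≠ 0 ∧ s' * r = r' * s := by
  have := H.isDomain
  have := Fintype.ofFinite σ
  by_contra! hcon
  obtain ⟨k₁, hr⟩ := exists_mem_wordLt H.adjoin_eq_top r
  obtain ⟨k₂, hs'⟩ := exists_mem_wordLt H.adjoin_eq_top s
  set k := max k₁ k₂
  replace hr := wordLt_mono (le_max_left _ _ : k₁ ≤ k) hr
  replace hs' := wordLt_mono (le_max_right _ _ : k₂ ≤ k) hs'
  have hfin := H.finite_wordLt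
  have step (n : ℕ) : 2 * Module.finrank ℂ (wordLt g n) ≤ Module.finrank ℂ (wordLt g (n + k)) := by
    let F : (wordLt g n × wordLt g n) →ₗ[ℂ] A :=
      ((LinearMap.mulRight ℂ r).comp (wordLt g n).subtype).coprod
        (-(LinearMap.mulRight ℂ s).comp (wordLt g n).subtype)
    have hF (x) : F x ∈ wordLt g (n + k) := by
      have h₁ := mul_mem_wordLt x.1.2 hr
      have h₂ := mul_mem_wordLt x.2.2 hs'
      have := wordLt_mono (Nat.sub_le _ _) (sub_mem h₁ h₂)
      simpa [F, sub_eq_add_neg] using this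
    have hinj : Function.Injective (F.codRestrict _ hF) := by
      rw [← LinearMap.ker_eq_bot, LinearMap.ker_eq_bot']
      rintro ⟨x, y⟩ h
      have h' : (x : A) * r = y * s := by
        have := congrArg Subtype.val h
        simpa [F, add_neg_eq_zero] using this
      have hx : (x : A) = 0 := by
        by_contra hx
        exact hcon _ _ hx h'
      have hy : (y : A) = 0 := by
        rw [hx, zero_mul, eq_comm, mul_eq_zero] at h'
        exact h'.resolve_right hs
      exact Prod.ext (Subtype.ext hx) (Subtype.ext hy)
    have := LinearMap.finrank_le_finrank_of_injective hinj
    rw [Module.finrank_prod] at this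
    omega
  have grow (m : ℕ) : 2 ^ m ≤ Module.finrank ℂ (wordLt g (1 + m * k)) := by
    induction m with
    | zero =>
      have : Nontrivial (wordLt g (1 + 0 * k)) :=
        ⟨⟨1, by simpa using one_mem_wordLt⟩, 0, fun h => one_ne_zero (congrArg Subtype.val h)⟩
      exact Module.finrank_pos
    | succ m ih =>
      have := step (1 + m * k)
      rw [show 1 + (m + 1) * k = 1 + m * k + k by ring, pow_succ]
      omega
  obtain ⟨m, hm⟩ := exists_pow_lt_two_pow k (Fintype.card σ)
  exact absurd ((grow m).trans (H.finrank_wordLt_le _)) (not_le.2 hm)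

open scoped nonZeroDivisors in
theorem nonempty_oreSet [Finite σ] : Nonempty (OreLocalization.OreSet A⁰) := by
  have := H.isDomain
  refine OreLocalization.nonempty_oreSet_iff_of_noZeroDivisors.2 fun r s => ?_
  obtain ⟨r', s', h0, h⟩ := H.exists_left_common_multiple r s (nonZeroDivisors.ne_zero s.2)
  exact ⟨r', ⟨s', mem_nonZeroDivisors_of_ne_zero h0⟩, h⟩

end IsSymbolRep

end WordFiltration
end QuantumPainleve

/-! ### Homomorphisms from the quotient skew field, and a criterion for injectivity -/

namespace QuantumPainleve
open scoped nonZeroDivisors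

section QuotField

variable {A : Type} [Ring A] [Algebra ℂ A] [IsDomain A] [OreLocalization.OreSet A⁰]

/-- `toQuot` as a homomorphism of algebras. -/
def toQuotHom (A : Type) [Ring A] [Algebra ℂ A] [IsDomain A] [OreLocalization.OreSet A⁰] :
    A →ₐ[ℂ] QuotField A :=
  { OreLocalization.numeratorRingHom with
    commutes' := fun _ => rfl }

omit [Algebra ℂ A] [IsDomain A] in
theorem toQuot_injective : Function.Injective (toQuot (R := A)) :=
  OreLocalization.numeratorHom_inj inf_le_left

theorem toQuotHom_injective : Function.Injective (toQuotHom A) := toQuot_injective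

theorem quotField_algHom_ext {B : Type*} [DivisionRing B] [Algebra ℂ B]
    {φ ψ : QuotField A →ₐ[ℂ] B} (h : φ.comp (toQuotHom A) = ψ.comp (toQuotHom A)) : φ = ψ := by
  ext x
  induction x using OreLocalization.ind with | _ r s
  have hs : toQuotHom A (s : A) ≠ 0 := by
    rw [Ne, map_eq_zero_iff _ toQuotHom_injective]
    exact nonZeroDivisors.ne_zero s.2
  have e : toQuotHom A s * (r /ₒ s) = toQuotHom A r :=
    OreLocalization.mul_cancel (t := 1)
  have e₁ := congrArg φ e
  have e₂ := congrArg ψ e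
  rw [map_mul] at e₁ e₂
  have h' (a : A) : φ (toQuotHom A a) = ψ (toQuotHom A a) := DFunLike.congr_fun h a
  rw [h', h'] at e₁
  exact mul_left_cancel₀ ((map_ne_zero ψ).2 hs) (e₁.trans e₂.symm)

/-- The extension of an injective homomorphism to the quotient skew field. -/
def extendQuot {B : Type*} [DivisionRing B] [Algebra ℂ B] (f : A →ₐ[ℂ] B)
    (hf : Function.Injective f) : QuotField A →ₐ[ℂ] B :=
  { OreLocalization.universalHom (f : A →+* B)
      (Units.liftRight ((f : A →* B).comp A⁰.subtype)
        (fun s => Units.mk0 (f s) (by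
          rw [Ne, map_eq_zero_iff _ hf]; exact nonZeroDivisors.ne_zero s.2))
        fun _ => rfl) (fun _ => rfl) with
    commutes' := fun r => by
      have := OreLocalization.universalHom_commutes (f : A →+* B)
        (Units.liftRight ((f : A →* B).comp A⁰.subtype)
        (fun s => Units.mk0 (f s) (by
          rw [Ne, map_eq_zero_iff _ hf]; exact nonZeroDivisors.ne_zero s.2))
        fun _ => rfl) (fun _ => rfl) (r := algebraMap ℂ A r)
      exact this.trans (f.commutes r) }

theorem extendQuot_toQuotHom {B : Type*} [DivisionRing B] [Algebra ℂ B] (f : A →ₐ[ℂ] B)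
    (hf : Function.Injective f) (a : A) : extendQuot f hf (toQuotHom A a) = f a :=
  OreLocalization.universalHom_commutes _ _ _

end QuotField

section Injective

/-- Left multiples of `b` by powers of `f` are right divisible by high powers of `f`. -/
def OrePowers {A : Type*} [Ring A] (f b : A) : Prop :=
  ∀ m : ℕ, ∃ (k : ℕ) (c : A), f ^ k * b = c * f ^ m

namespace OrePowers
variable {A : Type*} [Ring A] {f b : A}

theorem of_commute (h : Commute f b) : OrePowers f b := fun m => ⟨m, b, (h.pow_left m).eq⟩

theorem exists_of_le {m k k' : ℕ} {c : A} (h : f ^ k * b = c * f ^ m) (hk : k ≤ k') :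
    ∃ c', f ^ k' * b = c' * f ^ m :=
  ⟨f ^ (k' - k) * c, by rw [mul_assoc, ← h, ← mul_assoc, ← pow_add, Nat.sub_add_cancel hk]⟩

theorem add {b' : A} (h : OrePowers f b) (h' : OrePowers f b') : OrePowers f (b + b') := fun m => by
  obtain ⟨k, c, e⟩ := h m
  obtain ⟨k', c', e'⟩ := h' m
  obtain ⟨d, e⟩ := exists_of_le e (le_max_left k k')
  obtain ⟨d', e'⟩ := exists_of_le e' (le_max_right k k')
  exact ⟨_, d + d', by rw [mul_add, e, e', add_mul]⟩

theorem mul {b' : A} (h : OrePowers f b) (h' : OrePowers f b') : OrePowers f (b * b') := fun m => by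
  obtain ⟨k', c', e'⟩ := h' m
  obtain ⟨k, c, e⟩ := h k'
  exact ⟨k, c * c', by rw [← mul_assoc, e, mul_assoc, e', mul_assoc]⟩

/-- Moving one factor `f` across `b` costs a commutator. After multiplication by `f ^ k` that
commutator lies in the left ideal generated by `f ^ m`, which is stable under right multiplication
by `f`. So modulo this ideal `f ^ (n + k) * b` equals `f ^ k * b * f ^ n`, and `n = m` finishes. -/
theorem of_comm (h : OrePowers f (f * b - b * f)) : OrePowers f b := fun m => by
  obtain ⟨k, c, e⟩ := h m
  have key (n : ℕ) : ∃ d, f ^ (n + k) * b = d * f ^ m + f ^ k * b * f ^ n := by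
    induction n with
    | zero => exact ⟨0, by simp⟩
    | succ n ih =>
      obtain ⟨d, hd⟩ := ih
      refine ⟨d * f + f ^ n * c, ?_⟩
      have e₁ : f ^ (n + 1 + k) * b = f ^ (n + k) * b * f + f ^ n * (f ^ k * (f * b - b * f)) := by
        rw [add_right_comm, pow_succ, pow_add]
        noncomm_ring
      have e₂ : f ^ m * f = f * f ^ m := (pow_succ f m).symm.trans (pow_succ' f m)
      rw [e₁, hd, e, add_mul, add_mul, mul_assoc d, e₂, pow_succ f n]
      noncomm_ring
  obtain ⟨d, hd⟩ := key m
  exact ⟨m + k, d + f ^ k * b, by rw [hd, add_mul]⟩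

theorem of_adjoin [Algebra ℂ A] {s : Set A} (hs : Algebra.adjoin ℂ s = ⊤)
    (h : ∀ x ∈ s, OrePowers f x) (b : A) : OrePowers f b := by
  have hb : b ∈ Algebra.adjoin ℂ s := hs ▸ Algebra.mem_top
  induction hb using Algebra.adjoin_induction with
  | mem x hx => exact h x hx
  | algebraMap r => exact of_commute (Algebra.commutes r f).symm
  | add x y _ _ hx hy => exact hx.add hy
  | mul x y _ _ hx hy => exact hx.mul hy

end OrePowers

/-- A homomorphism `σ` that fixes `f` and is, up to powers of `f`, an involution on generators is
injective. -/
theorem injective_of_involutive_up_to_powers {A B : Type*} [Ring A] [Algebra ℂ A] [IsDomain A]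
    [Ring B] [IsDomain B] [Algebra ℂ B] (ι σ : A →ₐ[ℂ] B) (hι : Function.Injective ι) {f : A}
    (hf : f ≠ 0) (hσf : σ f = ι f) (hO : ∀ b, OrePowers f b) {s : Set A}
    (hs : Algebra.adjoin ℂ s = ⊤)
    (h : ∀ x ∈ s, ∃ (n : ℕ) (b : A), ι f ^ n * σ x = ι b ∧ σ b = ι f ^ n * ι x) :
    Function.Injective σ := by
  have key (x : A) : ∃ (n : ℕ) (b : A), ι f ^ n * σ x = ι b ∧ σ b = ι f ^ n * ι x := by
    have hx : x ∈ Algebra.adjoin ℂ s := hs ▸ Algebra.mem_top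
    induction hx using Algebra.adjoin_induction with
    | mem x hx => exact h x hx
    | algebraMap r => exact ⟨0, algebraMap ℂ A r, by simp, by simp⟩
    | add x y _ _ hx hy =>
      obtain ⟨n, b, h₁, h₂⟩ := hx
      obtain ⟨m, c, h₃, h₄⟩ := hy
      refine ⟨n + m, f ^ m * b + f ^ n * c, ?_, ?_⟩
      · rw [map_add, map_add, map_mul, map_mul, ← h₁, ← h₃, map_pow, map_pow, ← mul_assoc,
          ← mul_assoc, ← pow_add, ← pow_add, mul_add, add_comm m]
      · rw [map_add, map_add, map_mul, map_mul, h₂, h₄, map_pow, map_pow, hσf, ← mul_assoc,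
          ← mul_assoc, ← pow_add, ← pow_add, mul_add, add_comm m]
    | mul x y _ _ hx hy =>
      obtain ⟨n, b, h₁, h₂⟩ := hx
      obtain ⟨m, d, h₃, h₄⟩ := hy
      -- The factor `ι f ^ m` that clears the denominator of `σ y` is needed to the right of `ι b`;
      -- the Ore property produces it from `f ^ k` on the left.
      obtain ⟨k, c, e⟩ := hO b m
      have e₁ := congrArg ι e
      have e₂ := congrArg σ e
      simp only [map_mul, map_pow, hσf] at e₁ e₂
      refine ⟨k + n, c * d, ?_, ?_⟩
      · rw [map_mul, map_mul, ← h₃, ← mul_assoc, ← mul_assoc, ← e₁, ← h₁, pow_add]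
        simp only [mul_assoc]
      · rw [map_mul, map_mul, h₄, ← mul_assoc, ← e₂, h₂, pow_add]
        simp only [mul_assoc]
  rw [injective_iff_map_eq_zero]
  intro x hx
  -- If `σ x = 0`, the first equation gives `b = 0`, and the second then gives `f ^ n * x = 0`.
  obtain ⟨n, b, h₁, h₂⟩ := key x
  rw [hx, mul_zero, eq_comm, map_eq_zero_iff _ hι] at h₁
  rw [h₁, map_zero, eq_comm, ← map_pow, ← map_mul, map_eq_zero_iff _ hι, mul_eq_zero] at h₂
  exact h₂.resolve_left (pow_ne_zero _ hf)

end Injective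
end QuantumPainleve

/-! ### Presented algebras and the Heisenberg representation -/

namespace QuantumPainleve
open MvPolynomial

section Presented

variable {X : Type*} {r : FreeAlgebra ℂ X → FreeAlgebra ℂ X → Prop}

/-- The class of a generator in a presented algebra. -/
abbrev presGen (r : FreeAlgebra ℂ X → FreeAlgebra ℂ X → Prop) (x : X) : RingQuot r :=
  RingQuot.mkAlgHom ℂ r (FreeAlgebra.ι ℂ x)

theorem adjoin_range_presGen : Algebra.adjoin ℂ (Set.range (presGen r)) = ⊤ := by
  have h : Set.range (presGen r) = RingQuot.mkAlgHom ℂ r '' Set.range (FreeAlgebra.ι ℂ) := by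
    rw [← Set.range_comp]; rfl
  rw [h, ← AlgHom.map_adjoin, FreeAlgebra.adjoin_range_ι, Algebra.map_top,
    AlgHom.range_eq_top]
  exact RingQuot.mkAlgHom_surjective ℂ r

theorem presAlg_algHom_ext {B : Type*} [Semiring B] [Algebra ℂ B] {φ ψ : RingQuot r →ₐ[ℂ] B}
    (h : ∀ x, φ (presGen r x) = ψ (presGen r x)) : φ = ψ :=
  RingQuot.ringQuot_ext' _ _ _ (FreeAlgebra.hom_ext (funext h))

theorem presGen_rel {a b : FreeAlgebra ℂ X} (h : r a b) :
    RingQuot.mkAlgHom ℂ r a = RingQuot.mkAlgHom ℂ r b :=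
  RingQuot.mkAlgHom_rel ℂ h

/-- The homomorphism from a presented algebra with given values on generators. -/
def presLift {B : Type*} [Semiring B] [Algebra ℂ B] (F : X → B)
    (hF : ∀ a b, r a b → FreeAlgebra.lift ℂ F a = FreeAlgebra.lift ℂ F b) : RingQuot r →ₐ[ℂ] B :=
  RingQuot.liftAlgHom ℂ ⟨FreeAlgebra.lift ℂ F, fun {a b} h => hF a b h⟩

theorem presLift_gen {B : Type*} [Semiring B] [Algebra ℂ B] (F : X → B)
    (hF : ∀ a b, r a b → FreeAlgebra.lift ℂ F a = FreeAlgebra.lift ℂ F b) (x : X) :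
    presLift F hF (presGen r x) = F x := by
  simp [presLift, presGen]

end Presented

section Heisenberg

variable {σ : Type*} (c : σ → σ → ℂ) (z : σ)

/-- The derivation `½ ∑ c i j X_z ∂_j` of the polynomial ring. -/
def heisenbergDer (i : σ) : Derivation ℂ (MvPolynomial σ ℂ) (MvPolynomial σ ℂ) :=
  mkDerivation ℂ fun j => (c i j / 2) • X z

/-- Multiplication by `X i` plus the derivation `heisenbergDer c z i`. -/
def heisenbergOp (i : σ) : Module.End ℂ (MvPolynomial σ ℂ) :=
  LinearMap.mulLeft ℂ (X i) + (heisenbergDer c z i : _ →ₗ[ℂ] _)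

theorem heisenbergOp_apply (i : σ) (q : MvPolynomial σ ℂ) :
    heisenbergOp c z i q = X i * q + heisenbergDer c z i q := rfl

theorem heisenbergDer_X (i j : σ) : heisenbergDer c z i (X j) = (c i j / 2) • X z :=
  mkDerivation_X _ _ _

variable {c z}

/-- Each derivation sends every variable to a multiple of `X z`, and `X z` is killed by all of them,
so both composites vanish on variables. -/
theorem heisenbergDer_comm (hz : ∀ i, c i z = 0) (i j : σ) (q : MvPolynomial σ ℂ) :
    heisenbergDer c z i (heisenbergDer c z j q) = heisenbergDer c z j (heisenbergDer c z i q) := by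
  have : ⁅heisenbergDer c z i, heisenbergDer c z j⁆ = 0 := by
    refine MvPolynomial.derivation_ext fun k => ?_
    simp [Derivation.commutator_apply, heisenbergDer_X, hz]
  have := DFunLike.congr_fun this q
  rwa [Derivation.commutator_apply, Derivation.zero_apply, sub_eq_zero] at this

/-- The multiplications commute and so do the derivations. Only the two cross terms remain; by skew
symmetry each contributes half of `c i j • X z`, which is the reason for the factor `1/2` in
`heisenbergDer`. The operator of `z` itself is plain multiplication, since its derivation is zero.
-/
theorem heisenbergOp_comm (hz : ∀ i, c i z = 0) (hc : ∀ i j, c i j = -c j i) (i j : σ) :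
    heisenbergOp c z i * heisenbergOp c z j - heisenbergOp c z j * heisenbergOp c z i =
      c i j • heisenbergOp c z z := by
  have hz' : heisenbergDer c z z = 0 := by
    refine MvPolynomial.derivation_ext fun k => ?_
    simp [heisenbergDer_X, hc z, hz]
  refine LinearMap.ext fun q => ?_
  simp only [LinearMap.sub_apply, Module.End.mul_apply, LinearMap.smul_apply, heisenbergOp_apply,
    map_add, Derivation.leibniz, heisenbergDer_X, hz', heisenbergDer_comm hz i j, smul_eq_mul,
    hc j i, Derivation.zero_apply, MvPolynomial.smul_eq_C_mul, map_neg, neg_div]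
  have h2 : (C (c i j / 2) : MvPolynomial σ ℂ) * 2 = C (c i j) := by
    rw [← map_ofNat C 2, ← map_mul]; simp
  rw [← h2]
  ring

theorem heisenbergDer_mem_polyLt (i : σ) (n : ℕ) (q : MvPolynomial σ ℂ) (hq : q ∈ polyLt σ n) :
    heisenbergDer c z i q ∈ polyLt σ n := by
  rw [polyLt_eq_span] at hq
  refine (Submodule.span_le.2 ?_ : _ ≤ (polyLt σ n).comap (heisenbergDer c z i : _ →ₗ[ℂ] _)) hq
  rintro _ ⟨m, hm, rfl⟩
  simp only [Submodule.comap_coe, Set.mem_preimage, SetLike.mem_coe]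
  change heisenbergDer c z i (monomial m 1) ∈ polyLt σ n
  rw [heisenbergDer, mkDerivation_monomial]
  refine Submodule.smul_mem _ _ (Submodule.sum_mem _ fun j hj => ?_)
  have hj' : Finsupp.single j 1 ≤ m := by
    rw [Finsupp.single_le_iff]
    exact Nat.one_le_iff_ne_zero.2 (Finsupp.mem_support_iff.1 hj)
  have hd : (m - Finsupp.single j 1).degree + 1 = m.degree := by
    conv_rhs => rw [← tsub_add_cancel_of_le hj', map_add, Finsupp.degree_single]
  replace hm : m.degree < n := hm
  dsimp only
  rw [smul_eq_mul]
  -- The derivation trades one variable of the monomial for `X z`, so the degree is unchanged.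
  exact polyLt_mono (by omega) (mul_mem_polyLt (monomial_mem_polyLt (n := n - 1) (by omega) _)
    (Submodule.smul_mem _ _ (X_mem_polyLt z)))

theorem isSymbolRep_of_heisenberg {A : Type*} [Ring A] [Algebra ℂ A] {g : σ → A}
    (hg : Algebra.adjoin ℂ (Set.range g) = ⊤)
    (hc : ∀ i j, g i * g j - g j * g i = c i j • g z)
    (φ : A →ₐ[ℂ] Module.End ℂ (MvPolynomial σ ℂ)) (hφ : ∀ i, φ (g i) = heisenbergOp c z i) :
    IsSymbolRep g φ where
  adjoin_eq_top := hg
  comm_mem i j := by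
    rw [hc]
    exact Submodule.smul_mem _ _ (gen_mem_wordLt z)
  act_mem i n q hq := by
    rw [hφ, heisenbergOp_apply, add_sub_cancel_left]
    exact heisenbergDer_mem_polyLt i n q hq

end Heisenberg

/-! ### The matrices on cyclic indices -/

section Indices

variable {l : ℕ}

theorem one_ne_zero_zmod (hl : 1 ≤ l) : (1 : ZMod (l + 1)) ≠ 0 := by
  have : Fact (1 < l + 1) := ⟨by omega⟩
  exact one_ne_zero

theorem two_ne_zero_zmod (hl : 2 ≤ l) : (2 : ZMod (l + 1)) ≠ 0 := by
  intro h
  have : ((2 : ℕ) : ZMod (l + 1)) = 0 := by exact_mod_cast h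
  rw [ZMod.natCast_eq_zero_iff] at this
  exact absurd (Nat.le_of_dvd two_pos this) (by omega)

theorem add_one_ne_sub_one (hl : 2 ≤ l) (i : ZMod (l + 1)) : i + 1 ≠ i - 1 := by
  intro h
  refine two_ne_zero_zmod hl ?_
  linear_combination h

theorem u_succ (i : ZMod (l + 1)) : u l i (i + 1) = 1 := by simp [u]

theorem u_pred (hl : 2 ≤ l) (i : ZMod (l + 1)) : u l i (i - 1) = -1 := by
  simp [u, (add_one_ne_sub_one hl i).symm]

theorem u_of_ne {i j : ZMod (l + 1)} (h₁ : j ≠ i + 1) (h₂ : j ≠ i - 1) : u l i j = 0 := by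
  simp [u, h₁, h₂]

theorem u_skew (hl : 2 ≤ l) (i j : ZMod (l + 1)) : u l i j = -u l j i := by
  by_cases h₁ : j = i + 1
  · subst h₁
    have := u_pred hl (i + 1)
    rw [add_sub_cancel_right] at this
    rw [this, u_succ, neg_neg]
  by_cases h₂ : j = i - 1
  · subst h₂
    have := u_succ (i - 1)
    rw [sub_add_cancel] at this
    rw [this, u_pred hl]
  rw [u_of_ne h₁ h₂, u_of_ne, neg_zero]
  · rintro rfl; simp at h₂
  · rintro rfl; simp at h₁

theorem u_self (hl : 2 ≤ l) (i : ZMod (l + 1)) : u l i i = 0 := by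
  have := u_skew hl i i
  omega

theorem a_self (i : ZMod (l + 1)) : a l i i = 2 := by simp [a]

theorem a_adj (hl : 2 ≤ l) {i j : ZMod (l + 1)} (h : j = i + 1 ∨ j = i - 1) : a l i j = -1 := by
  have h10 := one_ne_zero_zmod (l := l) (by omega)
  have : j ≠ i := by
    rintro rfl
    rcases h with h | h
    · exact h10 (by linear_combination -h)
    · exact h10 (by linear_combination h)
  simp [a, this, h]

theorem a_of_ne {i j : ZMod (l + 1)} (h₀ : j ≠ i) (h₁ : j ≠ i + 1) (h₂ : j ≠ i - 1) :
    a l i j = 0 := by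
  simp [a, h₀, h₁, h₂]

end Indices

/-! ### The algebra for `l ≥ 2` is an Ore domain -/

section Alg

variable {l : ℕ}

theorem adjoin_range_gen : Algebra.adjoin ℂ (Set.range (Alg.gen l)) = ⊤ := adjoin_range_presGen

instance : Finite (Gen l) :=
  Finite.of_surjective
    (fun x : ZMod (l + 1) ⊕ ZMod (l + 1) ⊕ Unit =>
      Sum.elim Gen.f (Sum.elim Gen.α fun _ => Gen.h) x) fun
    | .f i => ⟨.inl i, rfl⟩
    | .α i => ⟨.inr (.inl i), rfl⟩
    | .h => ⟨.inr (.inr ()), rfl⟩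

/-- Elements of a ring that satisfy the defining relations of `Alg l`. -/
structure AlgRelations (l : ℕ) {B : Type*} [Ring B] (f α : ZMod (l + 1) → B) (h : B) : Prop where
  f_f : ∀ i j, f i * f j - f j * f i = (u l i j : B) * h
  f_α : ∀ i j, f i * α j = α j * f i
  α_α : ∀ i j, α i * α j = α j * α i
  h_f : ∀ j, h * f j = f j * h
  h_α : ∀ j, h * α j = α j * h

/-- The map on generators with given values. -/
def Gen.elim {l : ℕ} {B : Type*} (f α : ZMod (l + 1) → B) (h : B) : Gen l → B
  | .f i => f i
  | .α i => α i
  | .h => h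

/-- The homomorphism from `Alg l` with given values on generators. -/
def Alg.lift {B : Type*} [Ring B] [Algebra ℂ B] {f α : ZMod (l + 1) → B} {h : B}
    (H : AlgRelations l f α h) : Alg l →ₐ[ℂ] B :=
  presLift (Gen.elim f α h) fun x y hr => by
    cases hr with
    | f_f_succ i =>
      simpa [Ring.lie_def, Gen.elim, u_succ] using H.f_f i (i + 1)
    | f_f i j h₁ h₂ =>
      simpa [Ring.lie_def, Gen.elim, u_of_ne h₁ h₂] using H.f_f i j
    | f_α i j => simp [Ring.lie_def, Gen.elim, H.f_α]
    | α_α i j => simp [Ring.lie_def, Gen.elim, H.α_α i j]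
    | h_f j => simp [Ring.lie_def, Gen.elim, H.h_f]
    | h_α j => simp [Ring.lie_def, Gen.elim, H.h_α]

theorem Alg.lift_gen {B : Type*} [Ring B] [Algebra ℂ B] {f α : ZMod (l + 1) → B} {h : B}
    (H : AlgRelations l f α h) (x : Gen l) : Alg.lift H (Alg.gen l x) = Gen.elim f α h x :=
  presLift_gen _ _ x

theorem comm_eq_u_mul (hl : 2 ≤ l) {B : Type*} [Ring B] {f : ZMod (l + 1) → B} {h : B}
    (hs : ∀ i, f i * f (i + 1) - f (i + 1) * f i = h)
    (hn : ∀ i j, j ≠ i + 1 → j ≠ i - 1 → f i * f j = f j * f i) (i j : ZMod (l + 1)) :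
    f i * f j - f j * f i = (u l i j : B) * h := by
  by_cases h₁ : j = i + 1
  · simp [h₁, u_succ, hs]
  by_cases h₂ : j = i - 1
  · have := hs j
    rw [h₂, sub_add_cancel] at this
    rw [h₂, u_pred hl, ← this]
    simp
  · simp [u_of_ne h₁ h₂, hn i j h₁ h₂]

theorem algRelations_gen (hl : 2 ≤ l) :
    AlgRelations l (fun i => Alg.gen l (.f i)) (fun i => Alg.gen l (.α i)) (Alg.gen l .h) where
  f_f := comm_eq_u_mul hl
    (fun i => by simpa [Ring.lie_def, Alg.gen] using presGen_rel (Rel.f_f_succ i))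
    (fun i j h₁ h₂ => by
      simpa [Ring.lie_def, Alg.gen, sub_eq_zero] using presGen_rel (Rel.f_f i j h₁ h₂))
  f_α i j := by
    simpa [Ring.lie_def, Alg.gen, sub_eq_zero] using presGen_rel (Rel.f_α (l := l) i j)
  α_α i j := by
    simpa [Ring.lie_def, Alg.gen, sub_eq_zero] using presGen_rel (Rel.α_α (l := l) i j)
  h_f j := by
    simpa [Ring.lie_def, Alg.gen, sub_eq_zero] using presGen_rel (Rel.h_f (l := l) j)
  h_α j := by
    simpa [Ring.lie_def, Alg.gen, sub_eq_zero] using presGen_rel (Rel.h_α (l := l) j)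

theorem intCast_smul_eq_mul {B : Type*} [Ring B] [Algebra ℂ B] (n : ℤ) (x : B) :
    (n : ℂ) • x = (n : B) * x := by
  rw [Algebra.smul_def, map_intCast]

/-- The coefficients of `h` in the commutators of the generators of `Alg l`. -/
def commCoeff (l : ℕ) : Gen l → Gen l → ℂ
  | .f i, .f j => u l i j
  | _, _ => 0

theorem exists_isSymbolRep (hl : 2 ≤ l) : ∃ φ, IsSymbolRep (Alg.gen l) φ := by
  have hz (i : Gen l) : commCoeff l i .h = 0 := by cases i <;> rfl
  have hc (i j : Gen l) : commCoeff l i j = -commCoeff l j i := by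
    cases i <;> cases j <;> simp [commCoeff]
    rw [u_skew hl, Int.cast_neg]
  have hop := heisenbergOp_comm hz hc
  have H : AlgRelations l (fun i => heisenbergOp (commCoeff l) .h (.f i))
      (fun i => heisenbergOp (commCoeff l) .h (.α i)) (heisenbergOp (commCoeff l) .h .h) := by
    refine ⟨fun i j => ?_, fun i j => ?_, fun i j => ?_, fun j => ?_, fun j => ?_⟩
    · rw [hop]
      exact intCast_smul_eq_mul (B := Module.End ℂ (MvPolynomial (Gen l) ℂ)) _ _
    all_goals rw [← sub_eq_zero, hop]; simp [commCoeff]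
  have G := algRelations_gen hl
  refine ⟨Alg.lift H, isSymbolRep_of_heisenberg (c := commCoeff l) (z := .h) adjoin_range_gen
    (fun i j => ?_) _ fun i => ?_⟩
  · rcases i with i | i | _ <;> rcases j with j | j | _ <;>
      simp only [commCoeff, zero_smul, sub_self, sub_eq_zero]
    · rw [G.f_f]; exact (intCast_smul_eq_mul _ _).symm
    · exact G.f_α i j
    · exact (G.h_f i).symm
    · exact (G.f_α j i).symm
    · exact G.α_α i j
    · exact (G.h_α i).symm
    · exact G.h_f j
    · exact G.h_α j
  · rw [Alg.lift_gen]
    cases i <;> rfl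

theorem Alg.isDomain (hl : 2 ≤ l) : IsDomain (Alg l) :=
  (exists_isSymbolRep hl).choose_spec.isDomain

open scoped nonZeroDivisors in
theorem Alg.nonempty_oreSet (hl : 2 ≤ l) : Nonempty (OreLocalization.OreSet (Alg l)⁰) :=
  (exists_isSymbolRep hl).choose_spec.nonempty_oreSet

theorem Alg.gen_ne_zero (hl : 2 ≤ l) (x : Gen l) : Alg.gen l x ≠ 0 :=
  (exists_isSymbolRep hl).choose_spec.gen_ne_zero x

end Alg
end QuantumPainleve

/-! ### Reflections preserve the relations, and the Weyl group relations for `l ≥ 2` -/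

namespace QuantumPainleve

theorem WeylRelations.definesRepresentation {l : ℕ} {G : Type} [Group G] {s : ZMod (l + 1) → G}
    {π : G} (H : WeylRelations l s π) : DefinesRepresentation l s π := by
  let F : WeylGen l → G := fun x => match x with
    | .s i => s i
    | .π => π
  have hF : ∀ r ∈ {r | WeylRelator l r}, FreeGroup.lift F r = 1 := by
    rintro _ (i | ⟨hl, i, j, hj⟩ | ⟨i, j, h₁, h₂⟩ | _ | i)
    · simpa [F] using H.sq i
    · simpa [F] using H.braid hl i j hj
    · simpa only [map_mul, map_inv, FreeGroup.lift_apply_of, mul_inv_eq_one] using H.comm i j h₁ h₂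
    · simpa [F] using H.π_pow
    · simpa only [map_mul, map_inv, FreeGroup.lift_apply_of, mul_inv_eq_one] using H.π_s i
  exact ⟨PresentedGroup.toGroup hF, fun i => PresentedGroup.toGroup.of hF,
    PresentedGroup.toGroup.of hF⟩

namespace AlgRelations

variable {l : ℕ}

theorem map {B C : Type*} [Ring B] [Ring C] {f α : ZMod (l + 1) → B} {h : B}
    (H : AlgRelations l f α h) (φ : B →+* C) :
    AlgRelations l (fun i => φ (f i)) (fun i => φ (α i)) (φ h) where
  f_f i j := by rw [← map_mul, ← map_mul, ← map_sub, H.f_f, map_mul, map_intCast]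
  f_α i j := by rw [← map_mul, H.f_α, map_mul]
  α_α i j := by rw [← map_mul, H.α_α, map_mul]
  h_f j := by rw [← map_mul, H.h_f, map_mul]
  h_α j := by rw [← map_mul, H.h_α, map_mul]

theorem u_add (i j t : ZMod (l + 1)) : u l (i + t) (j + t) = u l i j := by
  simp only [u, add_right_comm i t 1, add_left_inj, add_sub_right_comm i t 1]

theorem rotate {B : Type*} [Ring B] {f α : ZMod (l + 1) → B} {h : B}
    (H : AlgRelations l f α h) (t : ZMod (l + 1)) :
    AlgRelations l (fun i => f (i + t)) (fun i => α (i + t)) h where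
  f_f i j := by rw [H.f_f, u_add]
  f_α i j := H.f_α _ _
  α_α i j := H.α_α _ _
  h_f j := H.h_f _
  h_α j := H.h_α _

variable {K : Type*} [DivisionRing K] {f α : ZMod (l + 1) → K} {h : K}

/-- The commutator with an inverse is `-(f i)⁻¹ [f j, f i] (f i)⁻¹`. What matters is that the result
depends on `j` only through the scalar `u l i j`. -/
theorem comm_div (H : AlgRelations l f α h) {i : ZMod (l + 1)} (hf : f i ≠ 0)
    (j : ZMod (l + 1)) :
    f j * (α i / f i) - α i / f i * f j = u l i j • (α i * (f i)⁻¹ * h * (f i)⁻¹) := by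
  have e : (f i)⁻¹ * f j = f j * (f i)⁻¹ - (f i)⁻¹ * (f i * f j - f j * f i) * (f i)⁻¹ := by
    rw [mul_sub, sub_mul, inv_mul_cancel_left₀ hf, mul_assoc _ (f j * f i), mul_assoc (f j),
      mul_inv_cancel₀ hf, mul_one, sub_sub_cancel]
  rw [div_eq_mul_inv, mul_assoc, e, H.f_f, ← mul_assoc, H.f_α, mul_sub, ← mul_assoc,
    sub_sub_cancel, ← zsmul_eq_mul]
  simp only [mul_smul_comm, smul_mul_assoc, mul_assoc]

/-- In the commutator of the images of `f j` and `f k`, the two cross terms are `u l i j * u l i k`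
times one common element, with opposite signs, by `comm_div`. They cancel, so the commutator is
unchanged. -/
theorem reflect (H : AlgRelations l f α h) {i : ZMod (l + 1)} (hf : f i ≠ 0) :
    AlgRelations l (fun j => f j + α i / f i * (u l i j : K))
      (fun j => α j - α i * (a l i j : K)) h where
  f_f j k := by
    have hj := H.comm_div hf j
    have hk := H.comm_div hf k
    rw [← H.f_f]
    simp only [← zsmul_eq_mul', add_mul, mul_add, smul_mul_assoc, mul_smul_comm]
    rw [sub_eq_iff_eq_add] at hj hk
    rw [hj, hk]
    module
  f_α j k := by
    have hα (j k) : Commute (α j) (α k) := H.α_α j k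
    have hfα (j k) : Commute (f j) (α k) := H.f_α j k
    have hx (k) : Commute (α i / f i) (α k) := by
      rw [div_eq_mul_inv]
      exact (hα i k).mul_left (hfα i k).inv_left₀
    exact ((((hfα j k).add_left ((hx k).mul_left (Int.cast_commute _ _)))).sub_right
      (((hfα j i).add_left ((hx i).mul_left (Int.cast_commute _ _))).mul_right
        (Int.commute_cast _ _))).eq
  α_α j k := by
    have hα (j k) : Commute (α j) (α k) := H.α_α j k
    exact ((((hα j k).sub_left ((hα i k).mul_left (Int.cast_commute _ _)))).sub_right
      (((hα j i).sub_left ((hα i i).mul_left (Int.cast_commute _ _))).mul_right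
        (Int.commute_cast _ _))).eq
  h_f j := by
    have hhα (j) : Commute h (α j) := H.h_α j
    have hhf (j) : Commute h (f j) := H.h_f j
    rw [div_eq_mul_inv]
    exact ((hhf j).add_right (((hhα i).mul_right (hhf i).inv_right₀).mul_right
      (Int.commute_cast _ _))).eq
  h_α j := by
    have hhα (j) : Commute h (α j) := H.h_α j
    exact ((hhα j).sub_right ((hhα i).mul_right (Int.commute_cast _ _))).eq

end AlgRelations

/-- Both sides become fractions over `P * Q + B`, as `P + B / Q` and the inner denominator on the
left share this right-hand numerator. `Q` need not commute with anything, so the identity applies to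
neighbouring generators `f`. -/
theorem continued_fraction_identity {K : Type*} [DivisionRing K] {A B P Q : K}
    (hBP : Commute B P) (hAB : Commute A B)
    (hP : P ≠ 0) (hQ : Q ≠ 0) (hD : Q - A / P ≠ 0) (hE : P + B / Q ≠ 0) (hAP : Commute A P) :
    A / P + B / (P + (A + B) / (Q - A / P)) = (A + B) / (P + B / Q) := by
  have e₁ : P + B / Q = (P * Q + B) / Q := by
    rw [add_div, mul_div_cancel_right₀ _ hQ]
  have hPQ : P * Q + B ≠ 0 := fun h0 => hE (by rw [e₁, h0, zero_div])
  have e₂ : P + (A + B) / (Q - A / P) = (P * Q + B) / (Q - A / P) := by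
    rw [eq_div_iff hD, add_mul, div_mul_cancel₀ _ hD, mul_sub, div_eq_mul_inv, ← mul_assoc P A,
      ← hAP.eq, mul_assoc A, mul_inv_cancel₀ hP]
    noncomm_ring
  rw [e₁, e₂, div_div_eq_mul_div, div_div_eq_mul_div, eq_div_iff hPQ, add_mul,
    div_mul_cancel₀ _ hPQ]
  have e₃ : A / P * B = B * (A / P) := by
    rw [div_eq_mul_inv]
    exact (hAB.mul_left hBP.symm.inv_left₀).eq
  have e₄ : A / P * (P * Q) = A * Q := by
    rw [← mul_assoc, div_mul_cancel₀ _ hP]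
  rw [mul_add, e₃, e₄]
  noncomm_ring

theorem mul_pow_three_eq_one {G : Type*} [Group G] {x y : G} (hx : x ^ 2 = 1) (hy : y ^ 2 = 1)
    (h : x * y * x = y * x * y) : (x * y) ^ 3 = 1 := by
  rw [pow_two] at hx hy
  calc (x * y) ^ 3 = (x * y * x) * (y * x * y) := by
        simp only [pow_succ, pow_zero, one_mul, mul_assoc]
    _ = (x * y * x) * (x * y * x) := by rw [h]
    _ = x * y * (x * x) * y * x := by simp only [mul_assoc]
    _ = 1 := by rw [hx, mul_one, mul_assoc x, hy, mul_one, hx]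

namespace Formulas

variable {l : ℕ} {K : Type} [DivisionRing K] [Algebra ℂ K] {f α : ZMod (l + 1) → K} {h : K}
  {s : ZMod (l + 1) → (K ≃ₐ[ℂ] K)} {π : K ≃ₐ[ℂ] K}

theorem s_self (hl : 2 ≤ l) (F : Formulas l f α h s π) (i : ZMod (l + 1)) : s i (f i) = f i := by
  rw [F.s_f, u_self hl]; simp

theorem s_α_self (F : Formulas l f α h s π) (i : ZMod (l + 1)) : s i (α i) = -α i := by
  rw [F.s_α, a_self]; push_cast; noncomm_ring

theorem s_f_succ (F : Formulas l f α h s π) (i : ZMod (l + 1)) :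
    s i (f (i + 1)) = f (i + 1) + α i / f i := by
  rw [F.s_f, u_succ]; simp

theorem s_succ_f (hl : 2 ≤ l) (F : Formulas l f α h s π) (i : ZMod (l + 1)) :
    s (i + 1) (f i) = f i - α (i + 1) / f (i + 1) := by
  have := u_pred hl (i + 1)
  rw [add_sub_cancel_right] at this
  rw [F.s_f, this]; simp [sub_eq_add_neg]

theorem s_α_adj (hl : 2 ≤ l) (F : Formulas l f α h s π) {i j : ZMod (l + 1)}
    (hj : j = i + 1 ∨ j = i - 1) : s i (α j) = α j + α i := by
  rw [F.s_α, a_adj hl hj]; simp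

/-- Each side sends `f k` to `f k` plus a combination of `u l i k` and `u l (i + 1) k`. Equating the
two coefficients gives `I₁` and `I₂`, both instances of `continued_fraction_identity`. -/
theorem braid_succ (hl : 2 ≤ l) (F : Formulas l f α h s π) (H : AlgRelations l f α h)
    (hf : ∀ i, f i ≠ 0)
    (hext : ∀ φ ψ : K ≃ₐ[ℂ] K, (∀ j, φ (f j) = ψ (f j)) → (∀ j, φ (α j) = ψ (α j)) →
      φ h = ψ h → φ = ψ) (i : ZMod (l + 1)) :
    s i * s (i + 1) * s i = s (i + 1) * s i * s (i + 1) := by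
  have hii : s i (f i) = f i := F.s_self hl i
  have hjj : s (i + 1) (f (i + 1)) = f (i + 1) := F.s_self hl (i + 1)
  have hij := F.s_f_succ i
  have hji := F.s_succ_f hl i
  have aii := F.s_α_self i
  have ajj := F.s_α_self (i + 1)
  have aij := F.s_α_adj hl (i := i) (j := i + 1) (.inl rfl)
  have aji := F.s_α_adj hl (i := i + 1) (j := i) (.inr (by ring))
  have hG : f (i + 1) + α i / f i ≠ 0 := by rw [← hij]; simpa using hf _
  have hF : f i - α (i + 1) / f (i + 1) ≠ 0 := by rw [← hji]; simpa using hf _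
  have hα (j k) : Commute (α j) (α k) := H.α_α j k
  have hfα (j k) : Commute (α j) (f k) := (H.f_α k j).symm
  have I₁ : α i / f i + α (i + 1) / (f i - (α i + α (i + 1)) / (f (i + 1) + α i / f i)) =
      (α i + α (i + 1)) / (f i - α (i + 1) / f (i + 1)) := by
    -- The sign of `Q` accounts for `s (i + 1)` subtracting its fraction from `f i`, while `s i`
    -- adds its own to `f (i + 1)`.
    have := continued_fraction_identity (A := α i) (B := α (i + 1)) (P := f i) (Q := -f (i + 1))
      (hfα _ _) (hα _ _) (hf _) (neg_ne_zero.2 (hf _))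
      (by rw [← neg_add']; exact neg_ne_zero.2 hG)
      (by rw [div_neg, ← sub_eq_add_neg]; exact hF) (hfα _ _)
    rwa [← neg_add', div_neg, div_neg, ← sub_eq_add_neg, ← sub_eq_add_neg] at this
  have I₂ : α (i + 1) / f (i + 1) +
      α i / (f (i + 1) + (α i + α (i + 1)) / (f i - α (i + 1) / f (i + 1))) =
      (α i + α (i + 1)) / (f (i + 1) + α i / f i) := by
    rw [add_comm (α i)]
    exact continued_fraction_identity (hfα _ _) (hα _ _) (hf _) (hf _) hF hG (hfα _ _)
  refine hext _ _ (fun k => ?_) (fun k => ?_) ?_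
  · simp only [AlgEquiv.mul_apply, F.s_f _ k, map_add, map_sub, map_mul, map_div₀, map_intCast,
      hii, hjj, hij, hji, aii, ajj, aij, aji]
    rw [add_comm (α (i + 1)) (α i), neg_add_cancel_comm_assoc, neg_add_cancel_left]
    have h₁ := congrArg (· * (u l i k : K)) I₁
    have h₂ := congrArg (· * (u l (i + 1) k : K)) I₂
    simp only [add_mul (_ / _)] at h₁ h₂
    rw [← h₁, ← h₂]
    abel
  · simp only [AlgEquiv.mul_apply, F.s_α _ k, map_add, map_sub, map_mul, map_intCast,
      aii, ajj, aij, aji]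
    noncomm_ring
  · simp only [AlgEquiv.mul_apply, F.s_h]

theorem sq (hl : 2 ≤ l) (F : Formulas l f α h s π)
    (hext : ∀ φ ψ : K ≃ₐ[ℂ] K, (∀ j, φ (f j) = ψ (f j)) → (∀ j, φ (α j) = ψ (α j)) →
      φ h = ψ h → φ = ψ) (i : ZMod (l + 1)) : s i ^ 2 = 1 := by
  rw [pow_two]
  refine hext _ _ (fun k => ?_) (fun k => ?_) ?_
  · simp only [AlgEquiv.mul_apply, F.s_f _ k, map_add, map_mul, map_div₀, map_intCast,
      F.s_self hl, F.s_α_self, AlgEquiv.one_apply, neg_div, neg_mul, add_neg_cancel_right]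
  · simp only [AlgEquiv.mul_apply, F.s_α _ k, map_sub, map_mul, map_intCast,
      F.s_α_self, AlgEquiv.one_apply, neg_mul, sub_neg_eq_add, sub_add_cancel]
  · simp only [AlgEquiv.mul_apply, F.s_h, AlgEquiv.one_apply]

theorem weylRelations (hl : 2 ≤ l) (F : Formulas l f α h s π) (H : AlgRelations l f α h)
    (hf : ∀ i, f i ≠ 0)
    (hext : ∀ φ ψ : K ≃ₐ[ℂ] K, (∀ j, φ (f j) = ψ (f j)) → (∀ j, φ (α j) = ψ (α j)) →
      φ h = ψ h → φ = ψ) : WeylRelations l s π where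
  sq := F.sq hl hext
  braid _ i j hj := by
    rcases hj with rfl | hj
    · exact mul_pow_three_eq_one (F.sq hl hext i) (F.sq hl hext _) (F.braid_succ hl H hf hext i)
    · obtain rfl : i = j + 1 := by rw [hj]; ring
      exact mul_pow_three_eq_one (F.sq hl hext _) (F.sq hl hext _)
        (F.braid_succ hl H hf hext j).symm
  comm i j h₁ h₂ := by
    by_cases h₀ : j = i
    · rw [h₀]
    have h₀' : i ≠ j := fun h => h₀ h.symm
    have h₁' : i ≠ j + 1 := by rintro rfl; simp at h₂
    have h₂' : i ≠ j - 1 := by rintro rfl; simp at h₁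
    have ij : s i (f j) = f j := by rw [F.s_f, u_of_ne h₁ h₂]; simp
    have ji : s j (f i) = f i := by rw [F.s_f, u_of_ne h₁' h₂']; simp
    have aij : s i (α j) = α j := by rw [F.s_α, a_of_ne h₀ h₁ h₂]; simp
    have aji : s j (α i) = α i := by rw [F.s_α, a_of_ne h₀' h₁' h₂']; simp
    refine hext _ _ (fun k => ?_) (fun k => ?_) ?_
    · simp only [AlgEquiv.mul_apply, F.s_f _ k, map_add, map_mul, map_div₀, map_intCast, ij, ji,
        aij, aji]
      exact add_right_comm _ _ _
    · simp only [AlgEquiv.mul_apply, F.s_α _ k, map_sub, map_mul, map_intCast, aij, aji]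
      exact sub_right_comm _ _ _
    · simp only [AlgEquiv.mul_apply, F.s_h]
  π_pow := by
    have key (n : ℕ) : (∀ j, (π ^ n) (f j) = f (j + n)) ∧ (∀ j, (π ^ n) (α j) = α (j + n)) ∧
        (π ^ n) h = h := by
      induction n with
      | zero => simp
      | succ n ih =>
        simp [pow_succ, AlgEquiv.mul_apply, F.π_f, F.π_α, F.π_h, ih.1, ih.2.1, ih.2.2, add_assoc,
          add_comm (1 : ZMod (l + 1))]
    obtain ⟨k₁, k₂, k₃⟩ := key (l + 1)
    refine hext _ _ (fun k => ?_) (fun k => ?_) ?_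
    · rw [k₁]; simp
    · rw [k₂]; simp
    · rw [k₃]; simp
  π_s i := by
    refine hext _ _ (fun k => ?_) (fun k => ?_) ?_
    · simp only [AlgEquiv.mul_apply, F.s_f, F.π_f, F.π_α, map_add, map_mul, map_div₀, map_intCast,
        AlgRelations.u_add]
    · have : a l (i + 1) (k + 1) = a l i k := by
        simp only [a, add_left_inj, add_sub_right_comm i 1 1]
      simp only [AlgEquiv.mul_apply, F.s_α, F.π_α, map_sub, map_mul, map_intCast, this]
    · simp only [AlgEquiv.mul_apply, F.s_h, F.π_h]

end Formulas
end QuantumPainleve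

/-! ### The automorphisms of the skew field for `l ≥ 2` -/

namespace QuantumPainleve
open scoped nonZeroDivisors

theorem quotField_algHom_ext_gen {X : Type} {r : FreeAlgebra ℂ X → FreeAlgebra ℂ X → Prop}
    [IsDomain (RingQuot r)] [OreLocalization.OreSet (RingQuot r)⁰] {B : Type*} [DivisionRing B]
    [Algebra ℂ B] {φ ψ : QuotField (RingQuot r) →ₐ[ℂ] B}
    (h : ∀ x, φ (toQuotHom _ (presGen r x)) = ψ (toQuotHom _ (presGen r x))) : φ = ψ :=
  quotField_algHom_ext (presAlg_algHom_ext h)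

section Alg

variable {l : ℕ} [IsDomain (Alg l)] [OreLocalization.OreSet (Alg l)⁰]

variable (l) in
/-- A generator of `Alg l` as an element of the quotient skew field. -/
abbrev Alg.quotGen (x : Gen l) : QuotField (Alg l) := toQuotHom (Alg l) (Alg.gen l x)

theorem Alg.quotGen_ne_zero (hl : 2 ≤ l) (x : Gen l) : Alg.quotGen l x ≠ 0 := by
  rw [Ne, map_eq_zero_iff _ toQuotHom_injective]
  exact Alg.gen_ne_zero hl x

theorem algRelations_quotGen (hl : 2 ≤ l) :
    AlgRelations l (fun i => Alg.quotGen l (.f i)) (fun i => Alg.quotGen l (.α i))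
      (Alg.quotGen l .h) :=
  (algRelations_gen hl).map (toQuotHom (Alg l) : Alg l →+* QuotField (Alg l))

-- On generators one commutator with `f i` already gives a multiple of `h`, which commutes with `f
-- i`.
omit [IsDomain (Alg l)] [OreLocalization.OreSet (Alg l)⁰] in
theorem Alg.orePowers (hl : 2 ≤ l) (i : ZMod (l + 1)) (b : Alg l) :
    OrePowers (Alg.gen l (.f i)) b := by
  have G := algRelations_gen hl
  refine OrePowers.of_adjoin adjoin_range_gen ?_ b
  rintro _ ⟨j | j | _, rfl⟩
  · refine OrePowers.of_comm (OrePowers.of_commute ?_)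
    rw [G.f_f]
    exact (Int.commute_cast _ _).mul_right (G.h_f i).symm
  · exact OrePowers.of_commute (G.f_α i j)
  · exact OrePowers.of_commute (G.h_f i).symm

/-- The homomorphism from `Alg l` to its quotient skew field given by the formulas for `s i`. -/
def Alg.reflectHom (hl : 2 ≤ l) (i : ZMod (l + 1)) : Alg l →ₐ[ℂ] QuotField (Alg l) :=
  Alg.lift ((algRelations_quotGen hl).reflect (Alg.quotGen_ne_zero hl (.f i)))

theorem Alg.reflectHom_f (hl : 2 ≤ l) (i j : ZMod (l + 1)) :
    Alg.reflectHom hl i (Alg.gen l (.f j)) = Alg.quotGen l (.f j) +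
      Alg.quotGen l (.α i) / Alg.quotGen l (.f i) * (u l i j : QuotField (Alg l)) :=
  Alg.lift_gen _ _

theorem Alg.reflectHom_α (hl : 2 ≤ l) (i j : ZMod (l + 1)) :
    Alg.reflectHom hl i (Alg.gen l (.α j)) =
      Alg.quotGen l (.α j) - Alg.quotGen l (.α i) * (a l i j : QuotField (Alg l)) :=
  Alg.lift_gen _ _

theorem Alg.reflectHom_h (hl : 2 ≤ l) (i : ZMod (l + 1)) :
    Alg.reflectHom hl i (Alg.gen l .h) = Alg.quotGen l .h :=
  Alg.lift_gen _ _

theorem Alg.reflectHom_α_self (hl : 2 ≤ l) (i : ZMod (l + 1)) :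
    Alg.reflectHom hl i (Alg.gen l (.α i)) = -Alg.quotGen l (.α i) := by
  rw [Alg.reflectHom_α, a_self, Int.cast_ofNat, mul_two, sub_add_cancel_left]

theorem Alg.reflectHom_f_self (hl : 2 ≤ l) (i : ZMod (l + 1)) :
    Alg.reflectHom hl i (Alg.gen l (.f i)) = Alg.quotGen l (.f i) := by
  rw [Alg.reflectHom_f, u_self hl, Int.cast_zero, mul_zero, add_zero]

theorem Alg.reflectHom_injective (hl : 2 ≤ l) (i : ZMod (l + 1)) :
    Function.Injective (Alg.reflectHom hl i) := by
  have H := algRelations_quotGen hl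
  have hf := Alg.quotGen_ne_zero hl (.f i)
  refine injective_of_involutive_up_to_powers (toQuotHom (Alg l)) _ toQuotHom_injective
    (Alg.gen_ne_zero hl (.f i)) (Alg.reflectHom_f_self hl i) (Alg.orePowers hl i)
    adjoin_range_gen ?_
  rintro _ ⟨j | j | _, rfl⟩
  -- One factor `f i` clears the denominator of the image of `f j`. Reflecting the result cancels
  -- the extra term, because `α i` changes sign.
  · refine ⟨1, Alg.gen l (.f i) * Alg.gen l (.f j) + Alg.gen l (.α i) * (u l i j : Alg l), ?_, ?_⟩
    · rw [Alg.reflectHom_f, map_add, map_mul, map_mul, map_intCast, pow_one, mul_add,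
        ← mul_assoc _ (_ / _), div_eq_mul_inv, ← mul_assoc _ _ (_)⁻¹, H.f_α, mul_assoc _ _ (_)⁻¹,
        mul_inv_cancel₀ hf, mul_one]
    · rw [map_add, map_mul, map_mul, map_intCast, Alg.reflectHom_f_self, Alg.reflectHom_f,
        Alg.reflectHom_α_self, pow_one, mul_add,
        ← mul_assoc _ (_ / _), div_eq_mul_inv, ← mul_assoc _ _ (_)⁻¹, H.f_α, mul_assoc _ _ (_)⁻¹,
        mul_inv_cancel₀ hf, mul_one, neg_mul, add_neg_cancel_right]
  · refine ⟨0, Alg.gen l (.α j) - Alg.gen l (.α i) * (a l i j : Alg l), ?_, ?_⟩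
    · rw [Alg.reflectHom_α, map_sub, map_mul, map_intCast, pow_zero, one_mul]
    · rw [map_sub, map_mul, map_intCast, Alg.reflectHom_α, Alg.reflectHom_α_self, pow_zero,
        one_mul, neg_mul, sub_neg_eq_add, sub_add_cancel]
  · exact ⟨0, Alg.gen l .h, by rw [Alg.reflectHom_h, pow_zero, one_mul],
      by rw [Alg.reflectHom_h, pow_zero, one_mul]⟩

/-- The rotation of the indices of the generators. -/
def Alg.rotateHom (hl : 2 ≤ l) (t : ZMod (l + 1)) : Alg l →ₐ[ℂ] Alg l :=
  Alg.lift ((algRelations_gen hl).rotate t)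

omit [IsDomain (Alg l)] [OreLocalization.OreSet (Alg l)⁰] in
theorem Alg.rotateHom_gen (hl : 2 ≤ l) (t : ZMod (l + 1)) (x : Gen l) :
    Alg.rotateHom hl t (Alg.gen l x) = Gen.elim (fun i => Alg.gen l (.f (i + t)))
      (fun i => Alg.gen l (.α (i + t))) (Alg.gen l .h) x :=
  Alg.lift_gen _ _

omit [IsDomain (Alg l)] [OreLocalization.OreSet (Alg l)⁰] in
theorem Alg.rotateHom_neg_comp (hl : 2 ≤ l) (t : ZMod (l + 1)) :
    (Alg.rotateHom hl (-t)).comp (Alg.rotateHom hl t) = AlgHom.id ℂ _ := by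
  refine presAlg_algHom_ext fun x => ?_
  change Alg.rotateHom hl (-t) (Alg.rotateHom hl t (Alg.gen l x)) = Alg.gen l x
  rw [Alg.rotateHom_gen]
  cases x <;> simp [Gen.elim, Alg.rotateHom_gen]

/-- The rotation of the quotient skew field. -/
def Alg.rotateQuot (hl : 2 ≤ l) (t : ZMod (l + 1)) : QuotField (Alg l) →ₐ[ℂ] QuotField (Alg l) :=
  extendQuot ((toQuotHom (Alg l)).comp (Alg.rotateHom hl t)) <|
    by
      rw [AlgHom.coe_comp]
      exact toQuotHom_injective.comp (Function.LeftInverse.injective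
        fun x => DFunLike.congr_fun (Alg.rotateHom_neg_comp hl t) x)

theorem Alg.rotateQuot_gen (hl : 2 ≤ l) (t : ZMod (l + 1)) (x : Gen l) :
    Alg.rotateQuot hl t (Alg.quotGen l x) = Gen.elim (fun i => Alg.quotGen l (.f (i + t)))
      (fun i => Alg.quotGen l (.α (i + t))) (Alg.quotGen l .h) x := by
  refine (extendQuot_toQuotHom _ _ _).trans ?_
  rw [AlgHom.comp_apply, Alg.rotateHom_gen]
  cases x <;> rfl

theorem Alg.rotateQuot_comp (hl : 2 ≤ l) {t t' : ZMod (l + 1)} (h : t + t' = 0) :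
    (Alg.rotateQuot hl t').comp (Alg.rotateQuot hl t) = AlgHom.id ℂ _ := by
  refine quotField_algHom_ext_gen fun x => ?_
  change Alg.rotateQuot hl t' (Alg.rotateQuot hl t (Alg.quotGen l x)) = Alg.quotGen l x
  rw [Alg.rotateQuot_gen]
  cases x <;> simp [Gen.elim, Alg.rotateQuot_gen, add_assoc, h]

/-- The endomorphism of the quotient skew field given by the formulas for `s i`. -/
def Alg.reflectQuot (hl : 2 ≤ l) (i : ZMod (l + 1)) : QuotField (Alg l) →ₐ[ℂ] QuotField (Alg l) :=
  extendQuot (Alg.reflectHom hl i) (Alg.reflectHom_injective hl i)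

theorem Alg.reflectQuot_gen (hl : 2 ≤ l) (i : ZMod (l + 1)) (x : Gen l) :
    Alg.reflectQuot hl i (Alg.quotGen l x) = Alg.reflectHom hl i (Alg.gen l x) :=
  extendQuot_toQuotHom _ _ _

theorem Alg.reflectQuot_comp_self (hl : 2 ≤ l) (i : ZMod (l + 1)) :
    (Alg.reflectQuot hl i).comp (Alg.reflectQuot hl i) = AlgHom.id ℂ _ := by
  refine quotField_algHom_ext_gen fun x => ?_
  change Alg.reflectQuot hl i (Alg.reflectQuot hl i (Alg.quotGen l x)) = Alg.quotGen l x
  rw [Alg.reflectQuot_gen]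
  rcases x with j | j | _
  · rw [Alg.reflectHom_f, map_add, map_mul, map_div₀, map_intCast]
    simp only [Alg.reflectQuot_gen]
    rw [Alg.reflectHom_f, Alg.reflectHom_f_self, Alg.reflectHom_α_self, neg_div, neg_mul,
      add_neg_cancel_right]
  · rw [Alg.reflectHom_α, map_sub, map_mul, map_intCast]
    simp only [Alg.reflectQuot_gen]
    rw [Alg.reflectHom_α, Alg.reflectHom_α_self, neg_mul, sub_neg_eq_add, sub_add_cancel]
  · rw [Alg.reflectHom_h, Alg.reflectQuot_gen, Alg.reflectHom_h]

variable (l) in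
theorem Alg.exists_formulas (hl : 2 ≤ l) : ∃ s π, Formulas l (fun i => Alg.quotGen l (.f i))
    (fun i => Alg.quotGen l (.α i)) (Alg.quotGen l .h) s π := by
  refine ⟨fun i => AlgEquiv.ofAlgHom _ _ (Alg.reflectQuot_comp_self hl i)
      (Alg.reflectQuot_comp_self hl i),
    AlgEquiv.ofAlgHom (Alg.rotateQuot hl 1) (Alg.rotateQuot hl (-1))
      (Alg.rotateQuot_comp hl (by simp)) (Alg.rotateQuot_comp hl (by simp)),
    fun i j => ?_, fun i j => ?_, fun i => ?_, fun j => ?_, fun j => ?_, ?_⟩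
  · exact (Alg.reflectQuot_gen hl i _).trans (Alg.reflectHom_f hl i j)
  · exact (Alg.reflectQuot_gen hl i _).trans (Alg.reflectHom_α hl i j)
  · exact (Alg.reflectQuot_gen hl i _).trans (Alg.reflectHom_h hl i)
  · exact Alg.rotateQuot_gen hl 1 _
  · exact Alg.rotateQuot_gen hl 1 _
  · exact Alg.rotateQuot_gen hl 1 _

theorem Alg.algEquiv_ext {φ ψ : QuotField (Alg l) ≃ₐ[ℂ] QuotField (Alg l)}
    (hf : ∀ j, φ (Alg.quotGen l (.f j)) = ψ (Alg.quotGen l (.f j)))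
    (hα : ∀ j, φ (Alg.quotGen l (.α j)) = ψ (Alg.quotGen l (.α j)))
    (hh : φ (Alg.quotGen l .h) = ψ (Alg.quotGen l .h)) : φ = ψ := by
  have : (φ : QuotField (Alg l) →ₐ[ℂ] QuotField (Alg l)) = ψ := by
    refine quotField_algHom_ext_gen fun x => ?_
    rcases x with j | j | _
    · exact hf j
    · exact hα j
    · exact hh
  exact AlgEquiv.ext fun x => DFunLike.congr_fun this x

variable (l) in
theorem Alg.exists_unique_automorphisms (hl : 2 ≤ l) :
    ∃ (s : ZMod (l + 1) → (QuotField (Alg l) ≃ₐ[ℂ] QuotField (Alg l)))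
      (π : QuotField (Alg l) ≃ₐ[ℂ] QuotField (Alg l)),
      (∀ s' π', Formulas l (fun i => toQuot (Alg.gen l (Gen.f i)))
          (fun i => toQuot (Alg.gen l (Gen.α i))) (toQuot (Alg.gen l Gen.h)) s' π' ↔
        s' = s ∧ π' = π) ∧
      WeylRelations l s π ∧
      DefinesRepresentation l s π := by
  obtain ⟨s, π, F⟩ := Alg.exists_formulas l hl
  have W := F.weylRelations hl (algRelations_quotGen hl) (fun i => Alg.quotGen_ne_zero hl _)
    fun φ ψ => Alg.algEquiv_ext
  refine ⟨s, π, fun s' π' => ⟨fun F' => ⟨funext fun i => ?_, ?_⟩, ?_⟩, W, W.definesRepresentation⟩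
  · exact Alg.algEquiv_ext (fun j => (F'.s_f i j).trans (F.s_f i j).symm)
      (fun j => (F'.s_α i j).trans (F.s_α i j).symm) ((F'.s_h i).trans (F.s_h i).symm)
  · exact Alg.algEquiv_ext (fun j => (F'.π_f j).trans (F.π_f j).symm)
      (fun j => (F'.π_α j).trans (F.π_α j).symm) (F'.π_h.trans F.π_h.symm)
  · rintro ⟨rfl, rfl⟩
    exact F

end Alg
end QuantumPainleve

/-! ### Type `A_1^{(1)}`: the central element and the Ore condition -/

namespace QuantumPainleve
open scoped nonZeroDivisors
open MvPolynomial

instance : Finite Gen₁ :=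
  Finite.of_surjective
    (fun x : Fin 3 ⊕ ZMod 2 ⊕ Unit =>
      Sum.elim Gen₁.f (Sum.elim Gen₁.α fun _ => Gen₁.h) x) fun
    | .f i => ⟨.inl i, rfl⟩
    | .α i => ⟨.inr (.inl i), rfl⟩
    | .h => ⟨.inr (.inr ()), rfl⟩

theorem zmod_two_cases (j : ZMod 2) : j = 0 ∨ j = 1 := by
  revert j; decide

/-- Elements of a ring that satisfy the defining relations of `Alg₁`. -/
structure Alg₁Relations {B : Type*} [Ring B] (f : Fin 3 → B) (α : ZMod 2 → B) (h : B) : Prop where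
  f₁_f₀ : f 1 * f 0 - f 0 * f 1 = h * f 2 + h * f 2
  f₀_f₂ : f 0 * f 2 - f 2 * f 0 = h
  f₂_f₁ : f 2 * f 1 - f 1 * f 2 = h
  f_α : ∀ i j, Commute (f i) (α j)
  α_α : ∀ i j, Commute (α i) (α j)
  f_h : ∀ i, Commute (f i) h
  h_α : ∀ j, Commute h (α j)

namespace Alg₁Relations

theorem map {B C : Type*} [Ring B] [Ring C] {f : Fin 3 → B} {α : ZMod 2 → B} {h : B}
    (H : Alg₁Relations f α h) (φ : B →+* C) :
    Alg₁Relations (fun i => φ (f i)) (fun i => φ (α i)) (φ h) where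
  f₁_f₀ := by simp only [← map_mul, ← map_sub, H.f₁_f₀]; simp
  f₀_f₂ := by simp only [← map_mul, ← map_sub, H.f₀_f₂]
  f₂_f₁ := by simp only [← map_mul, ← map_sub, H.f₂_f₁]
  f_α i j := (H.f_α i j).map φ
  α_α i j := (H.α_α i j).map φ
  f_h i := (H.f_h i).map φ
  h_α j := (H.h_α j).map φ

/-- The relations in terms of `f₀`, `f₂` and the central element `t = f₀ + f₁ + f₂²`. -/
theorem of_central {B : Type*} [Ring B] {p q t h : B} {α : ZMod 2 → B}
    (hpq : p * q - q * p = h) (htp : Commute t p) (htq : Commute t q)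
    (hp : Commute p h) (hq : Commute q h) (ht : Commute t h) (hpα : ∀ j, Commute p (α j))
    (hqα : ∀ j, Commute q (α j)) (htα : ∀ j, Commute t (α j)) (hα : ∀ i j, Commute (α i) (α j))
    (hhα : ∀ j, Commute h (α j)) : Alg₁Relations ![p, t - p - q ^ 2, q] α h where
  f₁_f₀ := by
    have e : (t - p - q ^ 2) * p - p * (t - p - q ^ 2) =
        (t * p - p * t) + q * (p * q - q * p) + (p * q - q * p) * q := by noncomm_ring
    simp only [Matrix.cons_val]
    rw [e, htp.eq, sub_self, hpq, hq.eq, zero_add]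
  f₀_f₂ := by simpa using hpq
  f₂_f₁ := by
    have e : q * (t - p - q ^ 2) - (t - p - q ^ 2) * q =
        (q * t - t * q) + (p * q - q * p) := by noncomm_ring
    simp only [Matrix.cons_val]
    rw [e, htq.eq, sub_self, hpq, zero_add]
  f_α i j := by
    have := ((htα j).sub_left (hpα j)).sub_left ((hqα j).pow_left 2)
    fin_cases i
    exacts [hpα j, this, hqα j]
  α_α := hα
  f_h i := by
    have := (ht.sub_left hp).sub_left (hq.pow_left 2)
    fin_cases i
    exacts [hp, this, hq]
  h_α := hhα

variable {B : Type*} [Ring B] {f : Fin 3 → B} {α : ZMod 2 → B} {h : B}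

/-- The relation `[f 1, f 0] = 2 h f 2` is balanced by `[f 2 ^ 2, f 0] = -2 h f 2`, and similarly
for `f 1`; for `f 2` the contributions of `f 0` and `f 1` cancel. -/
theorem commute_central (H : Alg₁Relations f α h) :
    (∀ i, Commute (f 0 + f 1 + f 2 ^ 2) (f i)) ∧ Commute (f 0 + f 1 + f 2 ^ 2) h ∧
      ∀ j, Commute (f 0 + f 1 + f 2 ^ 2) (α j) := by
  refine ⟨fun i => sub_eq_zero.1 ?_,
    ((H.f_h 0).add_left (H.f_h 1)).add_left ((H.f_h 2).pow_left 2),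
    fun j => ((H.f_α 0 j).add_left (H.f_α 1 j)).add_left ((H.f_α 2 j).pow_left 2)⟩
  have e₀ : (f 0 + f 1 + f 2 ^ 2) * f 0 - f 0 * (f 0 + f 1 + f 2 ^ 2) =
      (f 1 * f 0 - f 0 * f 1) - f 2 * (f 0 * f 2 - f 2 * f 0) - (f 0 * f 2 - f 2 * f 0) * f 2 := by
    noncomm_ring
  have e₁ : (f 0 + f 1 + f 2 ^ 2) * f 1 - f 1 * (f 0 + f 1 + f 2 ^ 2) =
      f 2 * (f 2 * f 1 - f 1 * f 2) + (f 2 * f 1 - f 1 * f 2) * f 2 - (f 1 * f 0 - f 0 * f 1) := by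
    noncomm_ring
  have e₂ : (f 0 + f 1 + f 2 ^ 2) * f 2 - f 2 * (f 0 + f 1 + f 2 ^ 2) =
      (f 0 * f 2 - f 2 * f 0) - (f 2 * f 1 - f 1 * f 2) := by
    noncomm_ring
  fin_cases i
  · refine e₀.trans ?_
    rw [H.f₁_f₀, H.f₀_f₂, (H.f_h 2).eq]; noncomm_ring
  · refine e₁.trans ?_
    rw [H.f₁_f₀, H.f₂_f₁, (H.f_h 2).eq]; noncomm_ring
  · refine e₂.trans ?_
    rw [H.f₂_f₁, H.f₀_f₂, sub_self]

theorem rotate (H : Alg₁Relations f α h) :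
    Alg₁Relations ![f 1, f 0, -f 2] (fun j => α (j + 1)) h where
  f₁_f₀ := by
    simp only [Matrix.cons_val]
    rw [← neg_sub, H.f₁_f₀, mul_neg, neg_add]
  f₀_f₂ := by
    simp only [Matrix.cons_val]
    rw [← H.f₂_f₁]; noncomm_ring
  f₂_f₁ := by
    simp only [Matrix.cons_val]
    rw [← H.f₀_f₂]; noncomm_ring
  f_α i j := by
    fin_cases i
    exacts [H.f_α 1 _, H.f_α 0 _, (H.f_α 2 _).neg_left]
  α_α i j := H.α_α _ _
  f_h i := by
    fin_cases i
    exacts [H.f_h 1, H.f_h 0, (H.f_h 2).neg_left]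
  h_α j := H.h_α _

/-- The image of `f 1` is written so that `f 0 + f 1 + f 2 ^ 2` is visibly fixed. By `of_central`
the one noncentral relation left is `[f 0, f 2 + α 0 / f 0] = h`, where the added fraction commutes
with `f 0`. -/
theorem reflect {K : Type*} [DivisionRing K] {f : Fin 3 → K} {α : ZMod 2 → K} {h : K}
    (H : Alg₁Relations f α h) :
    Alg₁Relations ![f 0, f 0 + f 1 + f 2 ^ 2 - f 0 - (f 2 + α 0 / f 0) ^ 2, f 2 + α 0 / f 0]
      (fun j => if j = 0 then -α 0 else α 1 + 2 * α 0) h := by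
  obtain ⟨tf, th, tα⟩ := H.commute_central
  have hx {y : K} (h₁ : Commute (α 0) y) (h₂ : Commute (f 0) y) : Commute (α 0 / f 0) y := by
    rw [div_eq_mul_inv]
    exact h₁.mul_left h₂.inv_left₀
  have hα' {y : K} (hy : ∀ j, Commute y (α j)) (j : ZMod 2) :
      Commute y ((fun j => if j = 0 then -α 0 else α 1 + 2 * α 0) j) := by
    dsimp only
    split_ifs
    · exact (hy 0).neg_right
    · exact (hy 1).add_right ((Commute.ofNat_right y 2).mul_right (hy 0))
  refine of_central ?_ (tf 0) ((tf 2).add_right (hx (tα 0).symm (tf 0).symm).symm) (H.f_h 0)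
    ((H.f_h 2).add_left (hx (H.h_α 0).symm (H.f_h 0))) th (hα' (H.f_α 0))
    (hα' fun j => (H.f_α 2 j).add_left (hx (H.α_α 0 j) (H.f_α 0 j))) (hα' tα)
    (fun i => hα' fun j => (hα' (fun i => H.α_α j i) i).symm) (hα' H.h_α)
  have := (hx (H.f_α 0 0).symm (Commute.refl (f 0))).eq
  rw [mul_add, add_mul, this, add_sub_add_right_eq_sub, H.f₀_f₂]

end Alg₁Relations

section Alg₁

theorem adjoin_range_gen₁ : Algebra.adjoin ℂ (Set.range Alg₁.gen) = ⊤ := adjoin_range_presGen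

/-- The map on generators with given values. -/
def Gen₁.elim {B : Type*} (f : Fin 3 → B) (α : ZMod 2 → B) (h : B) : Gen₁ → B
  | .f i => f i
  | .α i => α i
  | .h => h

/-- The homomorphism from `Alg₁` with given values on generators. -/
def Alg₁.lift {B : Type*} [Ring B] [Algebra ℂ B] {f : Fin 3 → B} {α : ZMod 2 → B} {h : B}
    (H : Alg₁Relations f α h) : Alg₁ →ₐ[ℂ] B :=
  presLift (Gen₁.elim f α h) fun x y hr => by
    cases hr with
    | f₁_f₀ => simpa [Ring.lie_def, Gen₁.elim, two_mul, add_mul] using H.f₁_f₀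
    | f₀_f₂ => simpa [Ring.lie_def, Gen₁.elim] using H.f₀_f₂
    | f₂_f₁ => simpa [Ring.lie_def, Gen₁.elim] using H.f₂_f₁
    | f_α i j => simp [Ring.lie_def, Gen₁.elim, (H.f_α i j).eq]
    | α_α i j => simp [Ring.lie_def, Gen₁.elim, (H.α_α i j).eq]
    | f_h i => simp [Ring.lie_def, Gen₁.elim, (H.f_h i).eq]
    | h_α j => simp [Ring.lie_def, Gen₁.elim, (H.h_α j).eq]

theorem Alg₁.lift_gen {B : Type*} [Ring B] [Algebra ℂ B] {f : Fin 3 → B} {α : ZMod 2 → B} {h : B}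
    (H : Alg₁Relations f α h) (x : Gen₁) : Alg₁.lift H (Alg₁.gen x) = Gen₁.elim f α h x :=
  presLift_gen _ _ x

theorem alg₁Relations_gen :
    Alg₁Relations (fun i => Alg₁.gen (.f i)) (fun i => Alg₁.gen (.α i)) (Alg₁.gen .h) where
  f₁_f₀ := by simpa [Ring.lie_def, Alg₁.gen, two_mul, add_mul] using presGen_rel Rel₁.f₁_f₀
  f₀_f₂ := by simpa [Ring.lie_def, Alg₁.gen] using presGen_rel Rel₁.f₀_f₂
  f₂_f₁ := by simpa [Ring.lie_def, Alg₁.gen] using presGen_rel Rel₁.f₂_f₁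
  f_α i j := by
    simpa [Ring.lie_def, Alg₁.gen, sub_eq_zero, commute_iff_eq] using presGen_rel (Rel₁.f_α i j)
  α_α i j := by
    simpa [Ring.lie_def, Alg₁.gen, sub_eq_zero, commute_iff_eq] using presGen_rel (Rel₁.α_α i j)
  f_h j := by
    simpa [Ring.lie_def, Alg₁.gen, sub_eq_zero, commute_iff_eq] using presGen_rel (Rel₁.f_h j)
  h_α j := by
    simpa [Ring.lie_def, Alg₁.gen, sub_eq_zero, commute_iff_eq] using presGen_rel (Rel₁.h_α j)

/-- The central element `f₀ + f₁ + f₂²`. -/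
def Alg₁.central : Alg₁ :=
  Alg₁.gen (.f 0) + Alg₁.gen (.f 1) + Alg₁.gen (.f 2) ^ 2

/-- The generators of `Alg₁` with `f₁` replaced by the central element. -/
def Alg₁.centralGen : Gen₁ → Alg₁
  | .f 1 => Alg₁.central
  | x => Alg₁.gen x

theorem adjoin_range_centralGen : Algebra.adjoin ℂ (Set.range Alg₁.centralGen) = ⊤ := by
  rw [eq_top_iff, ← adjoin_range_gen₁]
  refine Algebra.adjoin_le ?_
  have hmem (x : Gen₁) : Alg₁.centralGen x ∈ Algebra.adjoin ℂ (Set.range Alg₁.centralGen) :=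
    Algebra.subset_adjoin ⟨x, rfl⟩
  have h₁ : Alg₁.gen (.f 1) = Alg₁.central - Alg₁.gen (.f 0) - Alg₁.gen (.f 2) ^ 2 := by
    rw [Alg₁.central]; abel
  rintro _ ⟨i | j | _, rfl⟩
  · fin_cases i
    · exact hmem (.f 0)
    · change Alg₁.gen (.f 1) ∈ _
      rw [h₁]
      exact sub_mem (sub_mem (hmem (.f 1)) (hmem (.f 0))) (pow_mem (hmem (.f 2)) 2)
    · exact hmem (.f 2)
  · exact hmem (.α j)
  · exact hmem .h

theorem comm_swap_eq_smul {B : Type*} [Ring B] [Algebra ℂ B] {x y h : B} (e : x * y - y * x = h) :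
    y * x - x * y = (-1 : ℂ) • h := by
  rw [← e, neg_smul, one_smul, neg_sub]

/-- The coefficients of `h` in the commutators of `Alg₁.centralGen`. -/
def commCoeff₁ : Gen₁ → Gen₁ → ℂ
  | .f 0, .f 2 => 1
  | .f 2, .f 0 => -1
  | _, _ => 0

/-- The original generators do not fit: `[f 1, f 0]` is quadratic. With the central element in place
of `f 1`, every commutator is a scalar multiple of `h`. -/
theorem Alg₁.exists_isSymbolRep : ∃ φ, IsSymbolRep Alg₁.centralGen φ := by
  have hz (i : Gen₁) : commCoeff₁ i .h = 0 := by
    rcases i with i | j | _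
    · fin_cases i <;> rfl
    all_goals rfl
  have hc (i j : Gen₁) : commCoeff₁ i j = -commCoeff₁ j i := by
    rcases i with i | i | _ <;> rcases j with j | j | _ <;> try fin_cases i
    all_goals try fin_cases j
    all_goals simp [commCoeff₁]
  have hop := heisenbergOp_comm hz hc
  have hop' (i j : Gen₁) (h0 : commCoeff₁ i j = 0) :
      Commute (heisenbergOp commCoeff₁ .h i) (heisenbergOp commCoeff₁ .h j) := by
    rw [commute_iff_eq, ← sub_eq_zero, hop, h0, zero_smul]
  have H := Alg₁Relations.of_central (p := heisenbergOp commCoeff₁ .h (.f 0))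
    (q := heisenbergOp commCoeff₁ .h (.f 2)) (t := heisenbergOp commCoeff₁ .h (.f 1))
    (h := heisenbergOp commCoeff₁ .h .h) (α := fun i => heisenbergOp commCoeff₁ .h (.α i))
    ((hop _ _).trans (one_smul _ _)) (hop' _ _ rfl) (hop' _ _ rfl) (hop' _ _ rfl) (hop' _ _ rfl)
    (hop' _ _ rfl) (fun j => hop' _ _ rfl) (fun j => hop' _ _ rfl) (fun j => hop' _ _ rfl)
    (fun i j => hop' _ _ rfl) (fun j => hop' _ _ rfl)
  have G := alg₁Relations_gen
  obtain ⟨tf, th, tα⟩ := G.commute_central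
  refine ⟨Alg₁.lift H, isSymbolRep_of_heisenberg (c := commCoeff₁) (z := .h)
    adjoin_range_centralGen (fun i j => ?_) _ fun i => ?_⟩
  · have comm (x y : Alg₁) (h : Commute x y) (r : ℂ) (hr : r = 0) :
        x * y - y * x = r • Alg₁.gen .h := by
      rw [h.eq, sub_self, hr, zero_smul]
    rcases i with i | i | _ <;> rcases j with j | j | _
    · fin_cases i <;> fin_cases j
      · exact comm _ _ (Commute.refl _) _ rfl
      · exact comm _ _ (tf 0).symm _ rfl
      · exact G.f₀_f₂.trans (one_smul ℂ _).symm
      · exact comm _ _ (tf 0) _ rfl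
      · exact comm _ _ (Commute.refl _) _ rfl
      · exact comm _ _ (tf 2) _ rfl
      · exact comm_swap_eq_smul G.f₀_f₂
      · exact comm _ _ (tf 2).symm _ rfl
      · exact comm _ _ (Commute.refl _) _ rfl
    · fin_cases i
      exacts [comm _ _ (G.f_α 0 j) _ rfl, comm _ _ (tα j) _ rfl, comm _ _ (G.f_α 2 j) _ rfl]
    · fin_cases i
      exacts [comm _ _ (G.f_h 0) _ rfl, comm _ _ th _ rfl, comm _ _ (G.f_h 2) _ rfl]
    · fin_cases j
      exacts [comm _ _ (G.f_α 0 i).symm _ rfl, comm _ _ (tα i).symm _ rfl,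
        comm _ _ (G.f_α 2 i).symm _ rfl]
    · exact comm _ _ (G.α_α i j) _ rfl
    · exact comm _ _ (G.h_α i).symm _ rfl
    · fin_cases j
      exacts [comm _ _ (G.f_h 0).symm _ rfl, comm _ _ th.symm _ rfl, comm _ _ (G.f_h 2).symm _ rfl]
    · exact comm _ _ (G.h_α j) _ rfl
    · exact comm _ _ (Commute.refl _) _ rfl
  · rcases i with i | i | _
    · fin_cases i
      · exact Alg₁.lift_gen H (.f 0)
      · change Alg₁.lift H Alg₁.central = _
        rw [Alg₁.central, map_add, map_add, map_pow, Alg₁.lift_gen, Alg₁.lift_gen, Alg₁.lift_gen]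
        simp only [Gen₁.elim, Matrix.cons_val]
        abel
      · exact Alg₁.lift_gen H (.f 2)
    · exact Alg₁.lift_gen H (.α i)
    · exact Alg₁.lift_gen H .h

theorem Alg₁.isDomain : IsDomain Alg₁ := Alg₁.exists_isSymbolRep.choose_spec.isDomain

theorem Alg₁.nonempty_oreSet : Nonempty (OreLocalization.OreSet Alg₁⁰) :=
  Alg₁.exists_isSymbolRep.choose_spec.nonempty_oreSet

theorem Alg₁.gen_f₀_ne_zero : Alg₁.gen (.f 0) ≠ 0 :=
  Alg₁.exists_isSymbolRep.choose_spec.gen_ne_zero (.f 0)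

end Alg₁
end QuantumPainleve

/-! ### The automorphisms of the skew field for `l = 1` -/

namespace QuantumPainleve
open scoped nonZeroDivisors

namespace Alg₁

variable [IsDomain Alg₁] [OreLocalization.OreSet Alg₁⁰]

/-- A generator of `Alg₁` as an element of the quotient skew field. -/
abbrev quotGen (x : Gen₁) : QuotField Alg₁ := toQuotHom Alg₁ (gen x)

theorem quotGen_f₀_ne_zero : quotGen (.f 0) ≠ 0 := by
  rw [Ne, map_eq_zero_iff _ toQuotHom_injective]
  exact gen_f₀_ne_zero

theorem relations_quotGen :
    Alg₁Relations (fun i => quotGen (.f i)) (fun i => quotGen (.α i)) (quotGen .h) :=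
  alg₁Relations_gen.map (toQuotHom Alg₁ : Alg₁ →+* QuotField Alg₁)

omit [IsDomain Alg₁] [OreLocalization.OreSet Alg₁⁰] in
theorem orePowers (b : Alg₁) : OrePowers (gen (.f 0)) b := by
  have G := alg₁Relations_gen
  refine OrePowers.of_adjoin adjoin_range_centralGen ?_ b
  rintro _ ⟨i | j | _, rfl⟩
  · fin_cases i
    · exact OrePowers.of_commute (Commute.refl _)
    · exact OrePowers.of_commute (G.commute_central.1 0).symm
    · refine OrePowers.of_comm (OrePowers.of_commute ?_)
      change Commute (gen (.f 0)) (gen (.f 0) * gen (.f 2) - gen (.f 2) * gen (.f 0))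
      rw [G.f₀_f₂]
      exact G.f_h 0
  · exact OrePowers.of_commute (G.f_α 0 j)
  · exact OrePowers.of_commute (G.f_h 0)

/-- The homomorphism from `Alg₁` to its quotient skew field given by the formulas for `s 0`. -/
def reflectHom : Alg₁ →ₐ[ℂ] QuotField Alg₁ := lift relations_quotGen.reflect

theorem reflectHom_f₀ : reflectHom (gen (.f 0)) = quotGen (.f 0) := lift_gen _ _

theorem reflectHom_f₂ : reflectHom (gen (.f 2)) =
    quotGen (.f 2) + quotGen (.α 0) / quotGen (.f 0) := lift_gen _ _

theorem reflectHom_f₁ : reflectHom (gen (.f 1)) =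
    quotGen (.f 0) + quotGen (.f 1) + quotGen (.f 2) ^ 2 - quotGen (.f 0) -
      (quotGen (.f 2) + quotGen (.α 0) / quotGen (.f 0)) ^ 2 := lift_gen _ _

theorem reflectHom_α₀ : reflectHom (gen (.α 0)) = -quotGen (.α 0) := lift_gen _ _

theorem reflectHom_α₁ : reflectHom (gen (.α 1)) = quotGen (.α 1) + 2 * quotGen (.α 0) :=
  lift_gen _ _

theorem reflectHom_h : reflectHom (gen .h) = quotGen .h := lift_gen _ _

theorem reflectHom_central : reflectHom central = toQuotHom Alg₁ central := by
  rw [central, map_add, map_add, map_pow, reflectHom_f₀, reflectHom_f₁, reflectHom_f₂,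
    map_add, map_add, map_pow]
  abel

theorem reflectHom_injective : Function.Injective reflectHom := by
  have H := relations_quotGen
  have hf := quotGen_f₀_ne_zero
  refine injective_of_involutive_up_to_powers (toQuotHom Alg₁) _ toQuotHom_injective
    gen_f₀_ne_zero reflectHom_f₀ orePowers adjoin_range_centralGen ?_
  rintro _ ⟨i | j | _, rfl⟩
  · fin_cases i
    · refine ⟨0, gen (.f 0), ?_, ?_⟩ <;> rw [pow_zero, one_mul] <;> exact reflectHom_f₀
    · refine ⟨0, central, ?_, ?_⟩ <;> rw [pow_zero, one_mul] <;> exact reflectHom_central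
    · have e : quotGen (.f 0) * (quotGen (.α 0) / quotGen (.f 0)) = quotGen (.α 0) := by
        rw [div_eq_mul_inv, ← mul_assoc, (H.f_α 0 0).eq, mul_assoc, mul_inv_cancel₀ hf, mul_one]
      -- Among the generators with the central element, `f 2` is the only one whose image has a
      -- denominator.
      refine ⟨1, gen (.f 0) * gen (.f 2) + gen (.α 0), ?_, ?_⟩
      · change quotGen (.f 0) ^ 1 * reflectHom (gen (.f 2)) = _
        rw [reflectHom_f₂, pow_one, mul_add, e, map_add, map_mul]
      · change _ = quotGen (.f 0) ^ 1 * quotGen (.f 2)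
        rw [map_add, map_mul, reflectHom_f₀, reflectHom_f₂, reflectHom_α₀, mul_add, e, pow_one,
          add_neg_cancel_right]
  · obtain rfl | rfl := zmod_two_cases j
    · refine ⟨0, -gen (.α 0), ?_, ?_⟩
      · rw [pow_zero, one_mul, map_neg]
        exact reflectHom_α₀
      · rw [pow_zero, one_mul, map_neg, reflectHom_α₀, neg_neg]
        rfl
    · refine ⟨0, gen (.α 1) + (gen (.α 0) + gen (.α 0)), ?_, ?_⟩
      · rw [pow_zero, one_mul, map_add, map_add, ← two_mul]
        exact reflectHom_α₁
      · rw [pow_zero, one_mul, map_add, map_add, reflectHom_α₀, reflectHom_α₁, two_mul, add_assoc,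
          add_add_add_comm, add_neg_cancel, add_zero, add_zero]
        rfl
  · refine ⟨0, gen .h, ?_, ?_⟩ <;> rw [pow_zero, one_mul] <;> exact reflectHom_h

/-- The endomorphism of the quotient skew field given by the formulas for `s 0`. -/
def reflectQuot : QuotField Alg₁ →ₐ[ℂ] QuotField Alg₁ :=
  extendQuot reflectHom reflectHom_injective

theorem reflectQuot_gen (x : Gen₁) : reflectQuot (quotGen x) = reflectHom (gen x) :=
  extendQuot_toQuotHom _ _ _

/-- The automorphism that exchanges the indices `0` and `1`. -/
def rotateHom : Alg₁ →ₐ[ℂ] Alg₁ := lift alg₁Relations_gen.rotate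

omit [IsDomain Alg₁] [OreLocalization.OreSet Alg₁⁰] in
theorem rotateHom_gen (x : Gen₁) : rotateHom (gen x) =
    Gen₁.elim ![gen (.f 1), gen (.f 0), -gen (.f 2)] (fun j => gen (.α (j + 1))) (gen .h) x :=
  lift_gen _ _

omit [IsDomain Alg₁] [OreLocalization.OreSet Alg₁⁰] in
theorem rotateHom_comp_self : rotateHom.comp rotateHom = AlgHom.id ℂ _ := by
  refine presAlg_algHom_ext fun x => ?_
  change rotateHom (rotateHom (gen x)) = gen x
  rw [rotateHom_gen]
  rcases x with i | j | _
  · fin_cases i <;> simp [Gen₁.elim, rotateHom_gen]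
  · obtain rfl | rfl := zmod_two_cases j <;> exact rotateHom_gen _
  · exact rotateHom_gen _

/-- The automorphism of the quotient skew field that exchanges the indices `0` and `1`. -/
def rotateQuot : QuotField Alg₁ →ₐ[ℂ] QuotField Alg₁ :=
  extendQuot ((toQuotHom Alg₁).comp rotateHom) <| by
    rw [AlgHom.coe_comp]
    exact toQuotHom_injective.comp (Function.LeftInverse.injective
      fun x => DFunLike.congr_fun rotateHom_comp_self x)

theorem rotateQuot_gen (x : Gen₁) : rotateQuot (quotGen x) =
    Gen₁.elim ![quotGen (.f 1), quotGen (.f 0), -quotGen (.f 2)] (fun j => quotGen (.α (j + 1)))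
      (quotGen .h) x := by
  refine (extendQuot_toQuotHom _ _ _).trans ?_
  rw [AlgHom.comp_apply, rotateHom_gen]
  rcases x with i | j | _
  · fin_cases i
    · rfl
    · rfl
    · exact map_neg (toQuotHom Alg₁) _
  · rfl
  · rfl

theorem rotateQuot_comp_self : rotateQuot.comp rotateQuot = AlgHom.id ℂ _ := by
  refine quotField_algHom_ext_gen fun x => ?_
  change rotateQuot (rotateQuot (quotGen x)) = quotGen x
  rw [rotateQuot_gen]
  rcases x with i | j | _
  · fin_cases i <;> simp [Gen₁.elim, rotateQuot_gen]
  · obtain rfl | rfl := zmod_two_cases j <;> exact rotateQuot_gen _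
  · exact rotateQuot_gen _

theorem reflectQuot_comp_self : reflectQuot.comp reflectQuot = AlgHom.id ℂ _ := by
  refine quotField_algHom_ext_gen fun x => ?_
  change reflectQuot (reflectQuot (quotGen x)) = quotGen x
  rw [reflectQuot_gen]
  have h₂ : reflectQuot (quotGen (.f 2) + quotGen (.α 0) / quotGen (.f 0)) = quotGen (.f 2) := by
    rw [map_add, map_div₀]
    simp only [reflectQuot_gen]
    rw [reflectHom_f₂, reflectHom_f₀, reflectHom_α₀, neg_div, add_neg_cancel_right]
  rcases x with i | j | _
  · fin_cases i
    · exact (congrArg reflectQuot reflectHom_f₀).trans ((reflectQuot_gen _).trans reflectHom_f₀)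
    · change reflectQuot (reflectHom (gen (.f 1))) = quotGen (.f 1)
      rw [reflectHom_f₁, map_sub, map_pow, h₂, map_sub, map_add, map_add, map_pow]
      simp only [reflectQuot_gen]
      rw [reflectHom_f₀, reflectHom_f₁, reflectHom_f₂]
      abel
    · exact (congrArg reflectQuot reflectHom_f₂).trans h₂
  · obtain rfl | rfl := zmod_two_cases j
    · rw [reflectHom_α₀, map_neg, reflectQuot_gen, reflectHom_α₀, neg_neg]
    · rw [reflectHom_α₁, two_mul, map_add, map_add]
      simp only [reflectQuot_gen]
      rw [reflectHom_α₀, reflectHom_α₁, two_mul, add_assoc,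
          add_add_add_comm, add_neg_cancel, add_zero, add_zero]
  · rw [reflectHom_h, reflectQuot_gen, reflectHom_h]

/-- The automorphism `s 0`. -/
def reflectEquiv : QuotField Alg₁ ≃ₐ[ℂ] QuotField Alg₁ :=
  AlgEquiv.ofAlgHom reflectQuot reflectQuot reflectQuot_comp_self reflectQuot_comp_self

/-- The automorphism `π`. -/
def rotateEquiv : QuotField Alg₁ ≃ₐ[ℂ] QuotField Alg₁ :=
  AlgEquiv.ofAlgHom rotateQuot rotateQuot rotateQuot_comp_self rotateQuot_comp_self

theorem reflectEquiv_mul_self : reflectEquiv * reflectEquiv = 1 :=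
  AlgEquiv.ext fun x => DFunLike.congr_fun reflectQuot_comp_self x

theorem rotateEquiv_mul_self : rotateEquiv * rotateEquiv = 1 :=
  AlgEquiv.ext fun x => DFunLike.congr_fun rotateQuot_comp_self x

theorem algEquiv_ext {φ ψ : QuotField Alg₁ ≃ₐ[ℂ] QuotField Alg₁}
    (hf₀ : φ (quotGen (.f 0)) = ψ (quotGen (.f 0)))
    (hf₁ : φ (quotGen (.f 1)) = ψ (quotGen (.f 1)))
    (hf₂ : φ (quotGen (.f 2)) = ψ (quotGen (.f 2)))
    (hα₀ : φ (quotGen (.α 0)) = ψ (quotGen (.α 0)))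
    (hα₁ : φ (quotGen (.α 1)) = ψ (quotGen (.α 1)))
    (hh : φ (quotGen .h) = ψ (quotGen .h)) : φ = ψ := by
  have : (φ : QuotField Alg₁ →ₐ[ℂ] QuotField Alg₁) = ψ := by
    refine quotField_algHom_ext_gen fun x => ?_
    rcases x with i | j | _
    · fin_cases i
      exacts [hf₀, hf₁, hf₂]
    · obtain rfl | rfl := zmod_two_cases j
      exacts [hα₀, hα₁]
    · exact hh
  exact AlgEquiv.ext fun x => DFunLike.congr_fun this x

end Alg₁

/-- Defining `s₁` as the conjugate of `s₀` by the involution `π` makes every relation formal.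
Commutation is only asked for `i = j`, as `i + 1` is the only other index. -/
theorem weylRelations_one {G : Type} [Group G] {s π : G} (hs : s * s = 1) (hπ : π * π = 1) :
    WeylRelations 1 (fun i => if i = 0 then s else π * s * π) π where
  sq i := by
    obtain rfl | rfl := zmod_two_cases i
    · simp [pow_two, hs]
    · change (π * s * π) ^ 2 = 1
      calc (π * s * π) ^ 2 = π * s * (π * π) * s * π := by simp only [pow_two, mul_assoc]
        _ = 1 := by rw [hπ, mul_one, mul_assoc π, hs, mul_one, hπ]
  braid h := absurd h (by norm_num)
  comm i j h₁ h₂ := by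
    obtain rfl | rfl := zmod_two_cases i <;> obtain rfl | rfl := zmod_two_cases j
    · rfl
    · exact absurd rfl h₁
    · exact absurd rfl h₁
    · rfl
  π_pow := by rw [pow_two, hπ]
  π_s i := by
    obtain rfl | rfl := zmod_two_cases i
    · simp [mul_assoc, hπ]
    · change π * (π * s * π) = s * π
      rw [← mul_assoc, ← mul_assoc, hπ, one_mul]

/-- Conjugating by `π` swaps `f 0` and `f 1` and negates `f 2`, which turns the formulas for `s₀`
into those for `s₁`. Commutation of `α 0` with `f 0` identifies `α 0 ^ 2 / f 0 ^ 2` with the square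
of the fraction. -/
theorem formulas₁_of_conj {K : Type} [DivisionRing K] [Algebra ℂ K] {f : Fin 3 → K}
    {α : ZMod 2 → K} {h : K} (hα : Commute (α 0) (f 0)) {s π : K ≃ₐ[ℂ] K}
    (s_f₀ : s (f 0) = f 0)
    (s_f₁ : s (f 1) = f 0 + f 1 + f 2 ^ 2 - f 0 - (f 2 + α 0 / f 0) ^ 2)
    (s_f₂ : s (f 2) = f 2 + α 0 / f 0) (s_α₀ : s (α 0) = -α 0)
    (s_α₁ : s (α 1) = α 1 + 2 * α 0) (s_h : s h = h)
    (π_f₀ : π (f 0) = f 1) (π_f₁ : π (f 1) = f 0) (π_f₂ : π (f 2) = -f 2)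
    (π_α₀ : π (α 0) = α 1) (π_α₁ : π (α 1) = α 0) (π_h : π h = h) :
    Formulas₁ f α h (fun i => if i = 0 then s else π * s * π) π := by
  have e : s (f 1) = f 1 - f 2 * (α 0 / f 0) - α 0 / f 0 * f 2 - α 0 ^ 2 / f 0 ^ 2 := by
    have e' : α 0 ^ 2 / f 0 ^ 2 = (α 0 / f 0) ^ 2 := by
      rw [div_eq_mul_inv, div_eq_mul_inv, hα.inv_right₀.mul_pow, inv_pow]
    rw [s_f₁, e']
    noncomm_ring
  constructor
  · exact s_f₀
  · exact e
  · exact s_f₂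
  · simp [AlgEquiv.mul_apply, e, π_f₀, π_f₁, π_f₂, π_α₀]
  · simp [AlgEquiv.mul_apply, s_f₀, π_f₀, π_f₁]
  · simp [AlgEquiv.mul_apply, s_f₂, π_f₀, π_f₂, π_α₀]
    abel
  · exact s_α₀
  · exact s_α₁
  · simp [AlgEquiv.mul_apply, s_α₁, π_α₀, π_α₁, two_mul]
  · simp [AlgEquiv.mul_apply, s_α₀, π_α₀, π_α₁]
  · intro i
    obtain rfl | rfl := zmod_two_cases i
    · exact s_h
    · change (π * s * π) h = h
      simp [AlgEquiv.mul_apply, s_h, π_h]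
  · exact π_f₀
  · exact π_f₁
  · exact π_f₂
  · exact π_α₀
  · exact π_α₁
  · exact π_h

theorem Alg₁.exists_unique_automorphisms [IsDomain Alg₁] [OreLocalization.OreSet Alg₁⁰] :
    ∃ (s : ZMod (1 + 1) → (QuotField Alg₁ ≃ₐ[ℂ] QuotField Alg₁))
      (π : QuotField Alg₁ ≃ₐ[ℂ] QuotField Alg₁),
      (∀ s' π', Formulas₁ (fun i => toQuot (Alg₁.gen (Gen₁.f i)))
          (fun i => toQuot (Alg₁.gen (Gen₁.α i))) (toQuot (Alg₁.gen Gen₁.h)) s' π' ↔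
        s' = s ∧ π' = π) ∧
      WeylRelations 1 s π ∧
      DefinesRepresentation 1 s π := by
  have W := weylRelations_one reflectEquiv_mul_self rotateEquiv_mul_self
  have F : Formulas₁ (fun i => Alg₁.quotGen (Gen₁.f i)) (fun i => Alg₁.quotGen (Gen₁.α i))
      (Alg₁.quotGen Gen₁.h) _ rotateEquiv :=
    formulas₁_of_conj (s := reflectEquiv) (relations_quotGen.f_α 0 0).symm
      ((reflectQuot_gen _).trans reflectHom_f₀) ((reflectQuot_gen _).trans reflectHom_f₁)
      ((reflectQuot_gen _).trans reflectHom_f₂) ((reflectQuot_gen _).trans reflectHom_α₀)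
      ((reflectQuot_gen _).trans reflectHom_α₁) ((reflectQuot_gen _).trans reflectHom_h)
      (rotateQuot_gen _) (rotateQuot_gen _) (rotateQuot_gen _) (rotateQuot_gen _)
      (rotateQuot_gen _) (rotateQuot_gen _)
  refine ⟨_, _, fun s' π' => ⟨fun F' => ⟨funext fun i => ?_, ?_⟩, ?_⟩, W, W.definesRepresentation⟩
  · obtain rfl | rfl := zmod_two_cases i
    · exact algEquiv_ext (F'.s₀_f₀.trans F.s₀_f₀.symm) (F'.s₀_f₁.trans F.s₀_f₁.symm)
        (F'.s₀_f₂.trans F.s₀_f₂.symm) (F'.s₀_α₀.trans F.s₀_α₀.symm)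
        (F'.s₀_α₁.trans F.s₀_α₁.symm) ((F'.s_h 0).trans (F.s_h 0).symm)
    · exact algEquiv_ext (F'.s₁_f₀.trans F.s₁_f₀.symm) (F'.s₁_f₁.trans F.s₁_f₁.symm)
        (F'.s₁_f₂.trans F.s₁_f₂.symm) (F'.s₁_α₀.trans F.s₁_α₀.symm)
        (F'.s₁_α₁.trans F.s₁_α₁.symm) ((F'.s_h 1).trans (F.s_h 1).symm)
  · exact algEquiv_ext (F'.π_f₀.trans F.π_f₀.symm) (F'.π_f₁.trans F.π_f₁.symm)
      (F'.π_f₂.trans F.π_f₂.symm) (F'.π_α₀.trans F.π_α₀.symm)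
      (F'.π_α₁.trans F.π_α₁.symm) (F'.π_h.trans F.π_h.symm)
  · rintro ⟨rfl, rfl⟩
    exact F

end QuantumPainleve

end

open QuantumPainleve in
open scoped nonZeroDivisors in
/-- For `l = 1` and for every `l ≥ 2`: the algebra is an Ore domain, and on its quotient skew field
the formulas define unique `ℂ`-automorphisms `s_i`, `π`, which satisfy the relations of the
extended affine Weyl group. The skew field is the same, up to canonical isomorphism, for every
choice of the witnesses for common multiples that an `OreSet` consists of. -/
theorem theorem2p2 :
    (∃ _ : IsDomain Alg₁,
      Nonempty (OreLocalization.OreSet Alg₁⁰) ∧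
      ∀ _ : OreLocalization.OreSet Alg₁⁰,
        ∃ (s : ZMod (1 + 1) → (QuotField Alg₁ ≃ₐ[ℂ] QuotField Alg₁))
          (π : QuotField Alg₁ ≃ₐ[ℂ] QuotField Alg₁),
          (∀ s' π', Formulas₁ (fun i => toQuot (Alg₁.gen (Gen₁.f i)))
              (fun i => toQuot (Alg₁.gen (Gen₁.α i))) (toQuot (Alg₁.gen Gen₁.h)) s' π' ↔
            s' = s ∧ π' = π) ∧
          WeylRelations 1 s π ∧
          DefinesRepresentation 1 s π) ∧
    (∀ l : ℕ, 2 ≤ l →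
      ∃ _ : IsDomain (Alg l),
        Nonempty (OreLocalization.OreSet (Alg l)⁰) ∧
        ∀ _ : OreLocalization.OreSet (Alg l)⁰,
          ∃ (s : ZMod (l + 1) → (QuotField (Alg l) ≃ₐ[ℂ] QuotField (Alg l)))
            (π : QuotField (Alg l) ≃ₐ[ℂ] QuotField (Alg l)),
            (∀ s' π', Formulas l (fun i => toQuot (Alg.gen l (Gen.f i)))
                (fun i => toQuot (Alg.gen l (Gen.α i))) (toQuot (Alg.gen l Gen.h)) s' π' ↔
              s' = s ∧ π' = π) ∧
            WeylRelations l s π ∧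
            DefinesRepresentation l s π) :=
  ⟨⟨Alg₁.isDomain, Alg₁.nonempty_oreSet, fun _ =>
      letI := Alg₁.isDomain
      Alg₁.exists_unique_automorphisms⟩,
    fun l hl => ⟨Alg.isDomain hl, Alg.nonempty_oreSet hl, fun _ =>
      letI := Alg.isDomain hl
      Alg.exists_unique_automorphisms l hl⟩⟩
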